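/- A $C^*$-seminorm on a complex $*$-algebra is a submultiplicative seminorm $p$ with $p(a^*a)=p(a)^2$. A unital locally $C^*$-algebra $\mathcal A$ is a unital complete Hausdorff topological $*$-algebra over $\mathbb C$ whose topology is given by a family of $C^*$-seminorms $\{p_\lambda\}_{\lambda\in\Lambda}$, $\Lambda$ directed, with $p_\lambda\le p_\mu$ for $\lambda\le\mu$. Put $\mathcal A_\lambda=\mathcal A/\ker p_\lambda$ (a $C^*$-algebra in the norm induced by $p_\lambda$), with quotient map $\pi_\lambda^{\mathcal A}$, and $p_\lambda^n([a_{ij}])=\|[\pi_\lambda^{\mathcal A}(a_{ij})]\|_{M_n(\mathcal A_\lambda)}$ on $M_n(\mathcal A)$. A matrix $M\in M_n(\mathcal A)$ is $\lambda$-positive if $M=b^*b+c$ with $b,c\in M_n(\mathcal A)$ and $p_\lambda^n(c)=0$. A local operator system in $\mathcal A$ is a self-adjoint linear subspace $\mathcal S\subseteq\mathcal A$ containing the unit; it generates $\mathcal A$ if the $*$-subalgebra generated by $\mathcal S$ is dense in $\mathcal A$. Let $\mathcal H$ be a Hilbert space. * A linear map $\psi:\mathcal A\to B(\mathcal H)$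 is local completely positive if there is $\lambda\in\Lambda$ such that, for all $n\ge 1$ and $[a_{ij}]\in M_n(\mathcal A)$, the operator $[\psi(a_{ij})]\in B(\mathcal H^{\oplus n})$ is positive whenever $[a_{ij}]$ is $\lambda$-positive, and $[\psi(a_{ij})]=0$ whenever $p_\lambda^n([a_{ij}])=0$. * A local representation is a $*$-morphism $\pi:\mathcal A\to B(\mathcal H)$ such that, for some $\lambda\in\Lambda$, $\|\pi(a)\|\le p_\lambda(a)$ for all $a\in\mathcal A$; it is irreducible if the commutant of $\pi(\mathcal A)$ in $B(\mathcal H)$ is $\mathbb C\,\mathrm{id}_{\mathcal H}$. * A linear map $\pi:\mathcal A\to B(\mathcal H)$ is an admissible local boundary representation for $\mathcal S$ if it is an irreducible local representation and there is $\lambda_0\in\Lambda$ such that $\pi$ is the unique unital local completely positive map $\psi:\mathcal A\to B(\mathcal H)$ with $\psi|_{\mathcal S}=\pi|_{\mathcal S}$ and $\|\psi(a)\|\le p_{\lambda_0}(a)$ for all $a\in\mathcal A$. **Proposition.** Let $\mathcal A_1$ and $\mathcal A_2$ be unital locally $C^*$-algebras with topologies given by families of $C^*$-seminorms $\{p_\lambda\}_{\lambda\in\Lambda}$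 and $\{q_\lambda\}_{\lambda\in\Lambda}$, indexed by the same directed set $\Lambda$, and let $\mathcal S_1\subseteq\mathcal A_1$, $\mathcal S_2\subseteq\mathcal A_2$ be local operator systems such that $\mathcal S_1$ generates $\mathcal A_1$ and $\mathcal S_2$ generates $\mathcal A_2$. Let $\varphi:\mathcal S_1\to\mathcal S_2$ be a surjective unital linear map that is local completely isometric, i.e. $q_\lambda^n([\varphi(s_{ij})])=p_\lambda^n([s_{ij}])$ for all $\lambda\in\Lambda$, $n\ge 1$ and $[s_{ij}]\in M_n(\mathcal S_1)$. Then for each Hilbert space $\mathcal H$ and each admissible local boundary representation $\pi_1:\mathcal A_1\to B(\mathcal H)$ for $\mathcal S_1$ there exists an admissible local boundary representation $\pi_2:\mathcal A_2\to B(\mathcal H)$ for $\mathcal S_2$ such that $\pi_2\circ\varphi=\pi_1|_{\mathcal S_1}$. -/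

import Mathlib

open scoped InnerProductSpace

/-- A `C⋆`-seminorm on a complex `⋆`-algebra: a submultiplicative seminorm `p` with
`p (a⋆ a) = p(a)²`. -/
structure CStarSeminorm (A : Type*) [Ring A] [StarRing A] [Algebra ℂ A] extends
    Seminorm ℂ A where
  mul_le' : ∀ a b : A, toFun (a * b) ≤ toFun a * toFun b
  star_mul_self' : ∀ a : A, toFun (star a * a) = toFun a * toFun a

namespace CStarSeminorm

noncomputable instance {A : Type*} [Ring A] [StarRing A] [Algebra ℂ A] :
    CoeFun (CStarSeminorm A) (fun _ => A → ℝ) where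
  coe p := p.toSeminorm

theorem mul_le {A : Type*} [Ring A] [StarRing A] [Algebra ℂ A] (p : CStarSeminorm A) (a b : A) :
    p (a * b) ≤ p a * p b := p.mul_le' a b

theorem star_mul_self {A : Type*} [Ring A] [StarRing A] [Algebra ℂ A] (p : CStarSeminorm A)
    (a : A) : p (star a * a) = p a * p a := p.star_mul_self' a

theorem le_star {A : Type*} [Ring A] [StarRing A] [Algebra ℂ A] (p : CStarSeminorm A) (a : A) :
    p a ≤ p (star a) := by
  have h1 := p.star_mul_self a
  have h2 := p.mul_le (star a) a
  have h0 : 0 ≤ p a := apply_nonneg p.toSeminorm a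
  have h0' : 0 ≤ p (star a) := apply_nonneg p.toSeminorm (star a)
  rcases h0.eq_or_lt with h | h
  · rw [← h]; exact h0'
  · rw [h1] at h2
    exact le_of_mul_le_mul_right h2 h

theorem map_star {A : Type*} [Ring A] [StarRing A] [Algebra ℂ A] (p : CStarSeminorm A) (a : A) :
    p (star a) = p a :=
  le_antisymm (by simpa using p.le_star (star a)) (p.le_star a)

/-- A copy of `A`, to be equipped with the topology of the single seminorm `p`. -/
def Carrier {A : Type*} [Ring A] [StarRing A] [Algebra ℂ A] (_p : CStarSeminorm A) : Type _ := A

section Carrier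

variable {A : Type*} [Ring A] [StarRing A] [Algebra ℂ A] (p : CStarSeminorm A)

instance instRingCarrier : Ring p.Carrier := inferInstanceAs (Ring A)

instance instStarRingCarrier : StarRing p.Carrier := inferInstanceAs (StarRing A)

instance instAlgebraCarrier : Algebra ℂ p.Carrier := inferInstanceAs (Algebra ℂ A)

instance instStarModuleCarrier [StarModule ℂ A] : StarModule ℂ p.Carrier :=
  inferInstanceAs (StarModule ℂ A)

noncomputable instance instSeminormedRingCarrier : SeminormedRing p.Carrier :=
  { instRingCarrier p, p.toSeminorm.toSeminormedAddCommGroup with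
    norm_mul_le := fun a b => p.mul_le a b }

theorem norm_carrier (a : p.Carrier) : ‖a‖ = p.toSeminorm a := rfl

noncomputable instance instNormedAlgebraCarrier : NormedAlgebra ℂ p.Carrier where
  norm_smul_le c a := (map_smul_eq_mul p.toSeminorm c a).le

theorem norm_star_carrier (a : p.Carrier) : ‖star a‖ = ‖a‖ := p.map_star a

theorem uniformContinuous_star_carrier :
    UniformContinuous (star : p.Carrier → p.Carrier) := by
  refine (LipschitzWith.of_dist_le_mul (K := 1) fun a b => ?_).uniformContinuous
  rw [dist_eq_norm, dist_eq_norm, ← star_sub, norm_star_carrier]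
  simp

end Carrier

/-- The `C⋆`-algebra `A_p` of a `C⋆`-seminorm `p`: the separated completion of `(A, p)`, i.e. the
completion of `A / ker p` in the norm induced by `p`. (When `A` is a locally `C⋆`-algebra and `p`
one of its defining seminorms, `A / ker p` is already complete and this is `A / ker p` itself.) -/
noncomputable def QuotientAlgebra {A : Type*} [Ring A] [StarRing A] [Algebra ℂ A] (p : CStarSeminorm A) :
    Type _ :=
  UniformSpace.Completion p.Carrier

section QuotientAlgebra

variable {A : Type*} [Ring A] [StarRing A] [Algebra ℂ A] (p : CStarSeminorm A)

noncomputable instance instNormedRingQuotientAlgebra : NormedRing p.QuotientAlgebra :=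
  inferInstanceAs (NormedRing (UniformSpace.Completion p.Carrier))

instance instCompleteSpaceQuotientAlgebra : CompleteSpace p.QuotientAlgebra :=
  inferInstanceAs (CompleteSpace (UniformSpace.Completion p.Carrier))

noncomputable instance instAlgebraQuotientAlgebra : Algebra ℂ p.QuotientAlgebra :=
  inferInstanceAs (Algebra ℂ (UniformSpace.Completion p.Carrier))

noncomputable instance instNormedAlgebraQuotientAlgebra : NormedAlgebra ℂ p.QuotientAlgebra where
  norm_smul_le c x :=
    norm_smul_le (α := ℂ) (β := UniformSpace.Completion p.Carrier) c x

/-- The canonical map `A → A_p`, as a function. -/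
noncomputable def toQuotient (a : A) : p.QuotientAlgebra :=
  ((show p.Carrier from a : p.Carrier) : UniformSpace.Completion p.Carrier)

theorem denseRange_toQuotient : DenseRange p.toQuotient :=
  UniformSpace.Completion.denseRange_coe (α := p.Carrier)

theorem norm_toQuotient (a : A) : ‖p.toQuotient a‖ = p a :=
  UniformSpace.Completion.norm_coe (E := p.Carrier) a

theorem toQuotient_add (a b : A) : p.toQuotient (a + b) = p.toQuotient a + p.toQuotient b :=
  UniformSpace.Completion.coe_add (α := p.Carrier) a b

theorem toQuotient_mul (a b : A) : p.toQuotient (a * b) = p.toQuotient a * p.toQuotient b :=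
  UniformSpace.Completion.coe_mul (α := p.Carrier) a b

theorem toQuotient_smul (c : ℂ) (a : A) : p.toQuotient (c • a) = c • p.toQuotient a :=
  UniformSpace.Completion.coe_smul (X := p.Carrier) c a

theorem toQuotient_one : p.toQuotient (1 : A) = 1 :=
  UniformSpace.Completion.coe_one p.Carrier

/-- The involution of `A_p` is the continuous extension of the one of `A`. -/
noncomputable instance instStarQuotientAlgebra : Star p.QuotientAlgebra where
  star := UniformSpace.Completion.map (star : p.Carrier → p.Carrier)

theorem toQuotient_star (a : A) : p.toQuotient (star a) = star (p.toQuotient a) :=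
  (UniformSpace.Completion.map_coe p.uniformContinuous_star_carrier a).symm

theorem continuous_star_quotient :
    Continuous (star : p.QuotientAlgebra → p.QuotientAlgebra) :=
  UniformSpace.Completion.continuous_map

noncomputable instance instStarRingQuotientAlgebra : StarRing p.QuotientAlgebra where
  star_involutive x := by
    refine p.denseRange_toQuotient.induction_on x
      (isClosed_eq (p.continuous_star_quotient.comp p.continuous_star_quotient) continuous_id)
      fun a => ?_
    rw [← toQuotient_star, ← toQuotient_star, star_star]
  star_mul x y := by
    refine p.denseRange_toQuotient.induction_on₂
      (isClosed_eq (p.continuous_star_quotient.comp continuous_mul)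
        ((p.continuous_star_quotient.comp continuous_snd).mul
          (p.continuous_star_quotient.comp continuous_fst))) (fun a b => ?_) x y
    rw [← toQuotient_mul, ← toQuotient_star, ← toQuotient_star, ← toQuotient_star,
      ← toQuotient_mul, star_mul]
  star_add x y := by
    refine p.denseRange_toQuotient.induction_on₂
      (isClosed_eq (p.continuous_star_quotient.comp continuous_add)
        ((p.continuous_star_quotient.comp continuous_fst).add
          (p.continuous_star_quotient.comp continuous_snd))) (fun a b => ?_) x y
    rw [← toQuotient_add, ← toQuotient_star, ← toQuotient_star, ← toQuotient_star,
      ← toQuotient_add, star_add]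

instance instCStarRingQuotientAlgebra : CStarRing p.QuotientAlgebra where
  norm_mul_self_le x := by
    refine p.denseRange_toQuotient.induction_on x
      (isClosed_le (continuous_norm.mul continuous_norm)
        (continuous_norm.comp (p.continuous_star_quotient.mul continuous_id))) fun a => ?_
    rw [← toQuotient_star, ← toQuotient_mul, norm_toQuotient, norm_toQuotient, star_mul_self]

instance instStarModuleQuotientAlgebra [StarModule ℂ A] : StarModule ℂ p.QuotientAlgebra where
  star_smul c x := by
    refine p.denseRange_toQuotient.induction_on x
      (isClosed_eq (p.continuous_star_quotient.comp (continuous_const_smul c))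
        ((continuous_const_smul (star c)).comp p.continuous_star_quotient)) fun a => ?_
    rw [← toQuotient_smul, ← toQuotient_star, ← toQuotient_star, star_smul, toQuotient_smul]

noncomputable instance instCStarAlgebraQuotientAlgebra [StarModule ℂ A] :
    CStarAlgebra p.QuotientAlgebra where

/-- The usual order of the `C⋆`-algebra `A_p`. -/
noncomputable instance instPartialOrderQuotientAlgebra [StarModule ℂ A] :
    PartialOrder p.QuotientAlgebra :=
  CStarAlgebra.spectralOrder p.QuotientAlgebra

instance instStarOrderedRingQuotientAlgebra [StarModule ℂ A] :
    StarOrderedRing p.QuotientAlgebra :=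
  CStarAlgebra.spectralOrderedRing p.QuotientAlgebra

end QuotientAlgebra

/-- The canonical `⋆`-morphism `π_p : A → A_p`. -/
noncomputable def proj {A : Type*} [Ring A] [StarRing A] [Algebra ℂ A] [StarModule ℂ A]
    (p : CStarSeminorm A) : A →⋆ₐ[ℂ] p.QuotientAlgebra where
  toFun := p.toQuotient
  map_one' := p.toQuotient_one
  map_mul' := p.toQuotient_mul
  map_zero' := by simpa using p.toQuotient_smul 0 0
  map_add' := p.toQuotient_add
  commutes' c := by
    rw [Algebra.algebraMap_eq_smul_one, Algebra.algebraMap_eq_smul_one, toQuotient_smul,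
      toQuotient_one]
  map_star' := p.toQuotient_star

/-- The `C⋆`-seminorm `pⁿ([a_ij]) = ‖[π_p(a_ij)]‖` of `M_n(A)`, the norm being the `C⋆`-norm of
`M_n(A_p)`. -/
noncomputable def matrixSeminorm {A : Type*} [Ring A] [StarRing A] [Algebra ℂ A] [StarModule ℂ A]
    (p : CStarSeminorm A) {n : ℕ} (M : Matrix (Fin n) (Fin n) A) : ℝ :=
  ‖CStarMatrix.ofMatrix (M.map p.proj)‖

/-- `M ∈ M_n(A)` is `p`-positive: `M = b⋆ b + c` in `M_n(A)` with `pⁿ(c) = 0`. -/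
def MatrixPositive {A : Type*} [Ring A] [StarRing A] [Algebra ℂ A] [StarModule ℂ A]
    (p : CStarSeminorm A) {n : ℕ} (M : Matrix (Fin n) (Fin n) A) : Prop :=
  ∃ b c : Matrix (Fin n) (Fin n) A, M = star b * b + c ∧ p.matrixSeminorm c = 0

end CStarSeminorm

/-- `A`, with its given uniform structure, is a (unital) locally `C⋆`-algebra whose topology is
determined by the upward filtered family `p` of `C⋆`-seminorms: `A` is Hausdorff and complete. -/
structure IsLocallyCStarAlgebra {A Λ : Type*} [Ring A] [StarRing A] [Algebra ℂ A]
    [UniformSpace A] [Preorder Λ] (p : Λ → CStarSeminorm A) : Prop where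
  nonempty : Nonempty Λ
  directed : IsDirectedOrder Λ
  mono : ∀ l m : Λ, l ≤ m → ∀ a : A, p l a ≤ p m a
  isUniformAddGroup : IsUniformAddGroup A
  withSeminorms : WithSeminorms (fun l => (p l).toSeminorm)
  t2 : T2Space A
  complete : CompleteSpace A

/-- A local operator system: a self-adjoint subspace containing the unit. -/
structure IsLocalOperatorSystem {A : Type*} [Ring A] [StarRing A] [Algebra ℂ A]
    (S : Submodule ℂ A) : Prop where
  star_mem : ∀ a ∈ S, star a ∈ S
  one_mem : (1 : A) ∈ S

/-- `S` generates `A` as a locally `C⋆`-algebra: the `⋆`-subalgebra generated by `S` is dense. -/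
def GeneratesLocallyCStar {A : Type*} [Ring A] [StarRing A] [Algebra ℂ A] [StarModule ℂ A]
    [TopologicalSpace A] (S : Submodule ℂ A) : Prop :=
  Dense (StarAlgebra.adjoin ℂ (S : Set A) : Set A)

/-- The operator on the Hilbert space direct sum `H^{⊕n}` given by an `n × n` matrix of bounded
operators on `H`: `(T ξ)_i = ∑ j, T_ij ξ_j`. -/
noncomputable def matrixOperator {H : Type*} [NormedAddCommGroup H] [InnerProductSpace ℂ H]
    {n : ℕ} (T : Matrix (Fin n) (Fin n) (H →L[ℂ] H)) :
    PiLp 2 (fun _ : Fin n => H) →L[ℂ] PiLp 2 (fun _ : Fin n => H) :=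
  (PiLp.continuousLinearEquiv 2 ℂ (fun _ : Fin n => H)).symm.toContinuousLinearMap ∘L
    ContinuousLinearMap.pi fun i => ∑ j, T i j ∘L PiLp.proj 2 (fun _ : Fin n => H) j

/-- A linear map `A → B(H)` is local completely positive: for some index `l`, all its
amplifications send `l`-positive matrices to positive operators and `l`-null matrices to `0`. -/
def IsLocalCP {A Λ H : Type*} [Ring A] [StarRing A] [Algebra ℂ A] [StarModule ℂ A]
    [NormedAddCommGroup H] [InnerProductSpace ℂ H] (p : Λ → CStarSeminorm A)
    (φ : A →ₗ[ℂ] (H →L[ℂ] H)) : Prop :=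
  ∃ l : Λ, ∀ (n : ℕ) (M : Matrix (Fin n) (Fin n) A),
    ((p l).MatrixPositive M → (matrixOperator (M.map φ)).IsPositive) ∧
    ((p l).matrixSeminorm M = 0 → M.map φ = 0)

/-- A local representation of `A` on `H`: a `⋆`-morphism `π : A → B(H)` with
`‖π a‖ ≤ p_l(a)` for all `a`, for some index `l`. -/
structure IsLocalRepresentation {A Λ H : Type*} [Ring A] [StarRing A] [Algebra ℂ A]
    [NormedAddCommGroup H] [InnerProductSpace ℂ H] [CompleteSpace H] (p : Λ → CStarSeminorm A)
    (π : A →ₗ[ℂ] (H →L[ℂ] H)) : Prop where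
  map_mul : ∀ a b : A, π (a * b) = π a * π b
  map_star : ∀ a : A, π (star a) = star (π a)
  bound : ∃ l : Λ, ∀ a : A, ‖π a‖ ≤ p l a

/-- The commutant of `π(A)` in `B(H)` consists of the scalar multiples of the identity. -/
def IsIrreducibleRep {A H : Type*} [Ring A] [Algebra ℂ A]
    [NormedAddCommGroup H] [InnerProductSpace ℂ H] (π : A →ₗ[ℂ] (H →L[ℂ] H)) : Prop :=
  ∀ T : H →L[ℂ] H, (∀ a : A, T * π a = π a * T) → ∃ c : ℂ, T = c • (1 : H →L[ℂ] H)

/-- `ψ` is a unital local completely positive map `A → B(H)` that agrees with `π` on `S` and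
satisfies `‖ψ a‖ ≤ p_l(a)` for all `a`. -/
structure IsUnitalLocalCPExtension {A Λ H : Type*} [Ring A] [StarRing A] [Algebra ℂ A]
    [StarModule ℂ A] [NormedAddCommGroup H] [InnerProductSpace ℂ H]
    (p : Λ → CStarSeminorm A) (S : Submodule ℂ A) (l : Λ)
    (π ψ : A →ₗ[ℂ] (H →L[ℂ] H)) : Prop where
  map_one : ψ 1 = 1
  localCP : IsLocalCP p ψ
  eqOn : ∀ s ∈ S, ψ s = π s
  bound : ∀ a : A, ‖ψ a‖ ≤ p l a

/-- `π` is an admissible local boundary representation for `S`: it is an irreducible local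
representation and, for some index `l`, it is the unique unital local completely positive map `ψ`
which extends `π|_S` and satisfies `‖ψ a‖ ≤ p_l(a)` for all `a`. -/
structure IsAdmissibleLocalBoundaryRep {A Λ H : Type*} [Ring A] [StarRing A] [Algebra ℂ A]
    [StarModule ℂ A] [NormedAddCommGroup H] [InnerProductSpace ℂ H] [CompleteSpace H]
    (p : Λ → CStarSeminorm A) (S : Submodule ℂ A) (π : A →ₗ[ℂ] (H →L[ℂ] H)) : Prop where
  localRep : IsLocalRepresentation p π
  irreducible : IsIrreducibleRep π
  unique : ∃ l : Λ, IsUnitalLocalCPExtension p S l π π ∧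
    ∀ ψ : A →ₗ[ℂ] (H →L[ℂ] H), IsUnitalLocalCPExtension p S l π ψ → ψ = π

/-- A linear map `φ : S₁ → S₂` is local completely isometric: `q_lⁿ([φ(s_ij)]) = p_lⁿ([s_ij])`
for all indices `l`, all `n` and all `[s_ij] ∈ M_n(S₁)`. -/
def IsLocalCompletelyIsometric {A₁ A₂ Λ : Type*}
    [Ring A₁] [StarRing A₁] [Algebra ℂ A₁] [StarModule ℂ A₁]
    [Ring A₂] [StarRing A₂] [Algebra ℂ A₂] [StarModule ℂ A₂]
    (p : Λ → CStarSeminorm A₁) (q : Λ → CStarSeminorm A₂)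
    {S₁ : Submodule ℂ A₁} {S₂ : Submodule ℂ A₂} (φ : S₁ →ₗ[ℂ] S₂) : Prop :=
  ∀ (l : Λ) (n : ℕ) (M : Matrix (Fin n) (Fin n) S₁),
    (q l).matrixSeminorm (M.map fun s => (φ s : A₂)) =
      (p l).matrixSeminorm (M.map fun s => (s : A₁))

/-!
Boundary representations are an invariant of the operator system, not of the algebra it generates.
Fix the index `l` for which `π₁` is the only unital local completely positive extension of its
restriction to `S₁` bounded by `p l`; everything then happens over the `C⋆`-algebras of `p l` and
`q l`.

The tool is the theorem of Arveson and Stinespring in the form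
`exists_dilation_of_completelyContractive`: a unital completely contractive map of a unital subspace
of a `C⋆`-algebra `B` into `B(H)` is a compression `V⋆ θ(·) V` of a representation `θ` of `B`.
It is proved in one step. Such a map `ρ` defines a functional on finitely supported matrices over the
subspace, indexed by the vectors of `H`, which is nonnegative on matrices with nonnegative real part
because `‖M - t‖² ≤ ‖M‖² + t²` for those and `t ≥ 0`. M. Riesz's theorem extends it to matrices over
`B`, and the GNS construction for the resulting positive kernel (`PositiveKernel`) gives `θ` and `V`.

Let `V⋆ σ(·) V` be any dilation of `φ s ↦ π₁ s` by a representation `σ` of the algebra of `q l`.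
Since `φ` is completely isometric, `s ↦ σ (φ s)` has a dilation `W⋆ θ(·) W` with `θ` a representation
of the algebra of `p l`. By uniqueness, the compression of `θ` along `W V` is `π₁`. As this is
multiplicative, `W V` intertwines it with `θ`, whence `σ (φ s) V = V π₁(s)`
(`apply_eq_of_unique_extension`). The range of `V` is therefore invariant under `σ (S₂)`, and under
`σ` because `S₂` generates; so `V⋆ σ(·) V` is a representation. A first dilation yields `π₂`. A
competing extension `ψ` of `π₂|_{S₂}` is again such a compression (`IsLocalCP.exists_dilation`), hence
multiplicative, hence equal to `π₂`.
-/

open scoped ComplexOrder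

/-! ### Positive kernels and their dilations -/

/-- A positive definite kernel on the index type `ι` with values in the linear functionals on the
`⋆`-algebra `B`: the sums `∑ i j, κ i j (star (u i) * u j)` are nonnegative for all finitely
supported families `u`. -/
structure PositiveKernel (ι B : Type*) [Ring B] [StarRing B] [Algebra ℂ B] where
  toFun : ι → ι → B →ₗ[ℂ] ℂ
  nonneg' : ∀ u : ι →₀ B, 0 ≤ u.sum fun i a => u.sum fun j b => toFun i j (star a * b)

namespace PositiveKernel

section Form

variable {ι B : Type*} [Ring B] [StarRing B] [Algebra ℂ B] (κ : PositiveKernel ι B)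

/-- The sesquilinear form `⟨u, v⟩ = ∑ i j, κ i j (star (u i) * v j)`. -/
noncomputable def form (u v : ι →₀ B) : ℂ :=
  u.sum fun i a => v.sum fun j b => κ.toFun i j (star a * b)

theorem form_self_nonneg (u : ι →₀ B) : 0 ≤ κ.form u u := κ.nonneg' u

theorem form_single_single (i j : ι) (a b : B) :
    κ.form (Finsupp.single i a) (Finsupp.single j b) = κ.toFun i j (star a * b) := by
  simp [form]

theorem form_add_left (u u' v : ι →₀ B) : κ.form (u + u') v = κ.form u v + κ.form u' v := by
  classical
  unfold form
  rw [Finsupp.sum_add_index']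
  · simp
  · intro i a a'
    simp [star_add, add_mul, Finsupp.sum_add]

theorem form_add_right (u v v' : ι →₀ B) : κ.form u (v + v') = κ.form u v + κ.form u v' := by
  classical
  unfold form
  rw [← Finsupp.sum_add]
  refine Finsupp.sum_congr fun i _ => ?_
  rw [Finsupp.sum_add_index'] <;> simp [mul_add]

theorem form_smul_right (c : ℂ) (u v : ι →₀ B) : κ.form u (c • v) = c * κ.form u v := by
  unfold form
  rw [Finsupp.mul_sum]
  refine Finsupp.sum_congr fun i _ => ?_
  rw [Finsupp.sum_smul_index' (by simp), Finsupp.mul_sum]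
  simp

/-- A sesquilinear form which is real on the diagonal is Hermitian, by polarization. -/
theorem conj_form [StarModule ℂ B] (u v : ι →₀ B) :
    (starRingEnd ℂ) (κ.form v u) = κ.form u v := by
  have smul_left : ∀ (c : ℂ) (u v : ι →₀ B), κ.form (c • u) v = star c * κ.form u v := by
    intro c u v
    unfold form
    rw [Finsupp.mul_sum, Finsupp.sum_smul_index' (by simp)]
    simp [Finsupp.mul_sum]
  -- polarize with `u + v` and `u + i v`
  have him : ∀ w, (κ.form w w).im = 0 := fun w => (Complex.nonneg_iff.1 (κ.nonneg' w)).2.symm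
  have h1 := him (u + v)
  have h2 := him (u + Complex.I • v)
  simp only [form_add_left, form_add_right, form_smul_right, smul_left, Complex.add_im, him] at h1 h2
  simp at h2
  have := him v
  apply Complex.ext
  · simp; linarith
  · simp; linarith

end Form

section LeftMul

variable {ι B : Type*} [Ring B] [Algebra ℂ B]

/-- Left multiplication of a family by an element of the algebra. -/
noncomputable def leftMul (b : B) : (ι →₀ B) →ₗ[ℂ] (ι →₀ B) :=
  Finsupp.mapRange.linearMap (LinearMap.mulLeft ℂ b)

theorem leftMul_single (b : B) (i : ι) (a : B) :
    leftMul b (Finsupp.single i a) = Finsupp.single i (b * a) := by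
  simp [leftMul]

theorem leftMul_add (a b : B) (u : ι →₀ B) : leftMul (a + b) u = leftMul a u + leftMul b u := by
  ext i; simp [leftMul, add_mul]

theorem leftMul_mul (a b : B) (u : ι →₀ B) : leftMul (a * b) u = leftMul a (leftMul b u) := by
  ext i; simp [leftMul]

theorem leftMul_smul_one (c : ℂ) (u : ι →₀ B) : leftMul (c • (1 : B)) u = c • u := by
  ext i; simp [leftMul]

theorem leftMul_one (u : ι →₀ B) : leftMul (1 : B) u = u := by
  ext i; simp [leftMul]

theorem leftMul_zero (u : ι →₀ B) : leftMul (0 : B) u = 0 := by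
  ext i; simp [leftMul]

end LeftMul

theorem form_leftMul_left {ι B : Type*} [Ring B] [StarRing B] [Algebra ℂ B]
    (κ : PositiveKernel ι B) (b : B) (u v : ι →₀ B) :
    κ.form (leftMul b u) v = κ.form u (leftMul (star b) v) := by
  unfold form leftMul
  rw [Finsupp.mapRange.linearMap_apply, Finsupp.sum_mapRange_index (by simp)]
  refine Finsupp.sum_congr fun i _ => ?_
  rw [Finsupp.mapRange.linearMap_apply, Finsupp.sum_mapRange_index (by simp)]
  simp [mul_assoc]

section Dilation

variable {ι B : Type*} [CStarAlgebra B] (κ : PositiveKernel ι B)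

/-- Left multiplication by `b` is bounded by `‖b‖` for the form: `‖b‖² - star b * b` is of the
form `star c * c`, and `c` contributes a nonnegative term. -/
theorem re_form_leftMul_le (b : B) (u : ι →₀ B) :
    (κ.form (leftMul b u) (leftMul b u)).re ≤ ‖b‖ ^ 2 * (κ.form u u).re := by
  let := CStarAlgebra.spectralOrder B
  have := CStarAlgebra.spectralOrderedRing B
  have hle : star b * b ≤ algebraMap ℝ B (‖b‖ ^ 2) := by
    have := IsSelfAdjoint.le_algebraMap_norm_self (IsSelfAdjoint.star_mul_self b)
    rwa [CStarRing.norm_star_mul_self, ← sq] at this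
  obtain ⟨c, hc⟩ := CStarAlgebra.nonneg_iff_eq_star_mul_self.1 (sub_nonneg.2 hle)
  have hdecomp : ((‖b‖ ^ 2 : ℝ) : ℂ) • (1 : B) = star c * c + star b * b := by
    rw [← hc, sub_add_cancel, Algebra.algebraMap_eq_smul_one, Complex.coe_smul]
  have hsum : ((‖b‖ ^ 2 : ℝ) : ℂ) * κ.form u u =
      κ.form (leftMul c u) (leftMul c u) + κ.form (leftMul b u) (leftMul b u) := by
    rw [form_leftMul_left, form_leftMul_left, ← leftMul_mul, ← leftMul_mul, ← form_add_right,
      ← leftMul_add, ← hdecomp, leftMul_smul_one, form_smul_right]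
  have hre := congrArg Complex.re hsum
  have hpos := (Complex.nonneg_iff.1 (κ.form_self_nonneg (leftMul c u))).1
  rw [Complex.re_ofReal_mul, Complex.add_re] at hre
  linarith

/-- The pre-Hilbert space of a positive kernel: the families `ι →₀ B` with the form of `κ`. -/
@[nolint unusedArguments]
def PreSpace (_κ : PositiveKernel ι B) : Type _ := ι →₀ B

noncomputable instance : AddCommGroup κ.PreSpace := inferInstanceAs (AddCommGroup (ι →₀ B))
noncomputable instance : Module ℂ κ.PreSpace := inferInstanceAs (Module ℂ (ι →₀ B))

/-- The identity map from families to the pre-Hilbert space. -/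
noncomputable def toPre : (ι →₀ B) ≃ₗ[ℂ] κ.PreSpace := LinearEquiv.refl ℂ _

/-- The positive semidefinite inner product of `κ.PreSpace`. -/
noncomputable abbrev preInnerCore : PreInnerProductSpace.Core ℂ κ.PreSpace where
  inner u v := κ.form (κ.toPre.symm u) (κ.toPre.symm v)
  conj_inner_symm u v := κ.conj_form _ _
  re_inner_nonneg u := (Complex.nonneg_iff.1 (κ.form_self_nonneg _)).1
  add_left u v w := by rw [map_add, form_add_left]
  smul_left u v c := by
    rw [map_smul, ← κ.conj_form, ← κ.conj_form (κ.toPre.symm u), κ.form_smul_right, map_mul]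

noncomputable instance : SeminormedAddCommGroup κ.PreSpace :=
  InnerProductSpace.Core.toSeminormedAddCommGroup (c := κ.preInnerCore)
noncomputable instance : InnerProductSpace ℂ κ.PreSpace :=
  InnerProductSpace.ofCore κ.preInnerCore

theorem inner_eq_form (u v : κ.PreSpace) :
    ⟪u, v⟫_ℂ = κ.form (κ.toPre.symm u) (κ.toPre.symm v) := rfl

/-- Left multiplication by `b` as a bounded operator on the pre-Hilbert space of the kernel. -/
noncomputable def leftMulCLM (b : B) : κ.PreSpace →L[ℂ] κ.PreSpace :=
  LinearMap.mkContinuous (κ.toPre.toLinearMap ∘ₗ leftMul b ∘ₗ κ.toPre.symm.toLinearMap) ‖b‖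
    fun u => by
      rw [← sq_le_sq₀ (norm_nonneg _) (by positivity), mul_pow,
        ← inner_self_eq_norm_sq (𝕜 := ℂ) u, ← inner_self_eq_norm_sq (𝕜 := ℂ), inner_eq_form,
        inner_eq_form]
      simpa using κ.re_form_leftMul_le b (κ.toPre.symm u)

theorem leftMulCLM_apply (b : B) (u : κ.PreSpace) :
    κ.leftMulCLM b u = κ.toPre (leftMul b (κ.toPre.symm u)) := rfl

/-- The Hilbert space of a positive kernel. -/
abbrev Space : Type _ := UniformSpace.Completion κ.PreSpace

/-- The representation of `B` by left multiplications on the Hilbert space of a kernel. -/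
noncomputable def rep : B →⋆ₐ[ℂ] (κ.Space →L[ℂ] κ.Space) where
  toFun b := (κ.leftMulCLM b).completion
  map_one' := by
    ext x
    induction x using UniformSpace.Completion.induction_on with
    | hp => apply isClosed_eq <;> fun_prop
    | ih u => simp [leftMulCLM_apply, leftMul_one]
  map_zero' := by
    ext x
    induction x using UniformSpace.Completion.induction_on with
    | hp => apply isClosed_eq <;> fun_prop
    | ih u => simp [leftMulCLM_apply, leftMul_zero, UniformSpace.Completion.coe_zero]
  map_add' a b := by
    ext x
    induction x using UniformSpace.Completion.induction_on with
    | hp => apply isClosed_eq <;> fun_prop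
    | ih u => simp [leftMulCLM_apply, leftMul_add, UniformSpace.Completion.coe_add]
  map_mul' a b := by
    ext x
    induction x using UniformSpace.Completion.induction_on with
    | hp => apply isClosed_eq <;> fun_prop
    | ih u => simp [leftMulCLM_apply, leftMul_mul]
  commutes' c := by
    ext x
    induction x using UniformSpace.Completion.induction_on with
    | hp => apply isClosed_eq <;> fun_prop
    | ih u => simp [Algebra.algebraMap_eq_smul_one, leftMulCLM_apply, leftMul_smul_one]
  map_star' b := by
    refine (ContinuousLinearMap.eq_adjoint_iff _ _).mpr fun x y => ?_
    induction x, y using UniformSpace.Completion.induction_on₂ with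
    | hp => apply isClosed_eq <;> fun_prop
    | ih u v => simp [inner_eq_form, leftMulCLM_apply, form_leftMul_left]

/-- The vector of the Hilbert space of a kernel that belongs to an index. -/
noncomputable def vec (i : ι) : κ.Space := (κ.toPre (Finsupp.single i 1) : κ.Space)

theorem inner_vec_rep_vec (i j : ι) (b : B) :
    ⟪κ.vec i, κ.rep b (κ.vec j)⟫_ℂ = κ.toFun i j b := by
  change ⟪κ.vec i, (κ.leftMulCLM b).completion (κ.vec j)⟫_ℂ = _
  simp [vec, inner_eq_form, leftMulCLM_apply, leftMul_single, form_single_single]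

end Dilation

end PositiveKernel

/-- A map between inner product spaces that preserves inner products is a linear isometry. -/
theorem exists_linearIsometry_of_inner {H K : Type*} [NormedAddCommGroup H] [InnerProductSpace ℂ H]
    [NormedAddCommGroup K] [InnerProductSpace ℂ K] (v : H → K)
    (hv : ∀ x y, ⟪v x, v y⟫_ℂ = ⟪x, y⟫_ℂ) : ∃ V : H →ₗᵢ[ℂ] K, ∀ x, V x = v x := by
  have hadd : ∀ x y, v (x + y) = v x + v y := fun x y => by
    rw [← sub_eq_zero, ← inner_self_eq_zero (𝕜 := ℂ)]
    simp only [inner_sub_left, inner_sub_right, inner_add_left, inner_add_right, hv]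
    ring
  have hsmul : ∀ (c : ℂ) x, v (c • x) = c • v x := fun c x => by
    rw [← sub_eq_zero, ← inner_self_eq_zero (𝕜 := ℂ)]
    simp only [inner_sub_left, inner_sub_right, inner_smul_left, inner_smul_right, hv]
    ring
  refine ⟨⟨⟨⟨v, hadd⟩, hsmul⟩, fun x => ?_⟩, fun x => rfl⟩
  have h := hv x x
  rw [inner_self_eq_norm_sq_to_K, inner_self_eq_norm_sq_to_K] at h
  have h' : ‖v x‖ ^ 2 = ‖x‖ ^ 2 := by exact_mod_cast h
  exact (pow_left_inj₀ (norm_nonneg _) (norm_nonneg _) two_ne_zero).1 h'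

/-- Stinespring's theorem for kernels: a positive kernel indexed by the vectors of `H` whose value
at the unit is the inner product of `H` is `⟪V x, θ(b) V y⟫` for a representation `θ` of `B` and an
isometry `V` of `H`. Linearity of `V` comes for free from its preserving inner products. -/
theorem PositiveKernel.exists_dilation {B : Type*} {H : Type*} [CStarAlgebra B]
    [NormedAddCommGroup H] [InnerProductSpace ℂ H] (κ : PositiveKernel H B)
    (hone : ∀ x y : H, κ.toFun x y 1 = ⟪x, y⟫_ℂ) :
    ∃ (θ : B →⋆ₐ[ℂ] (κ.Space →L[ℂ] κ.Space)) (V : H →ₗᵢ[ℂ] κ.Space),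
      ∀ b x y, ⟪V x, θ b (V y)⟫_ℂ = κ.toFun x y b := by
  obtain ⟨V, hV⟩ := exists_linearIsometry_of_inner κ.vec fun x y => by
    rw [← hone x y, ← κ.inner_vec_rep_vec, map_one, one_apply_eq_self]
  exact ⟨κ.rep, V, fun b x y => by rw [hV, hV, κ.inner_vec_rep_vec]⟩

/-! ### Operator matrices and accretive matrices -/

section MatrixOperator

variable {H : Type*} [NormedAddCommGroup H] [InnerProductSpace ℂ H] {n : ℕ}

theorem matrixOperator_apply (T : Matrix (Fin n) (Fin n) (H →L[ℂ] H))
    (x : PiLp 2 (fun _ : Fin n => H)) (i : Fin n) :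
    matrixOperator T x i = ∑ j, T i j (x j) := by
  simp [matrixOperator]

theorem matrixOperator_add (T U : Matrix (Fin n) (Fin n) (H →L[ℂ] H)) :
    matrixOperator (T + U) = matrixOperator T + matrixOperator U := by
  ext x i
  simp [matrixOperator_apply, Finset.sum_add_distrib]

theorem matrixOperator_smul (c : ℂ) (T : Matrix (Fin n) (Fin n) (H →L[ℂ] H)) :
    matrixOperator (c • T) = c • matrixOperator T := by
  ext x i
  simp [matrixOperator_apply, Finset.smul_sum]

theorem matrixOperator_one : matrixOperator (1 : Matrix (Fin n) (Fin n) (H →L[ℂ] H)) = 1 := by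
  ext x i
  rw [matrixOperator_apply, Finset.sum_eq_single i]
  · simp
  · intro j _ hj
    simp [Matrix.one_apply_ne hj.symm]
  · simp

theorem matrixOperator_mul (T U : Matrix (Fin n) (Fin n) (H →L[ℂ] H)) :
    matrixOperator (T * U) = matrixOperator T * matrixOperator U := by
  ext x i
  simp only [matrixOperator_apply, mul_apply_eq_comp, Matrix.mul_apply, map_sum,
    sum_apply]
  exact Finset.sum_comm

theorem inner_matrixOperator (T : Matrix (Fin n) (Fin n) (H →L[ℂ] H))
    (x y : PiLp 2 (fun _ : Fin n => H)) :
    ⟪x, matrixOperator T y⟫_ℂ = ∑ i, ∑ j, ⟪x i, T i j (y j)⟫_ℂ := by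
  simp [PiLp.inner_apply, matrixOperator_apply, inner_sum]

theorem matrixOperator_star [CompleteSpace H] (T : Matrix (Fin n) (Fin n) (H →L[ℂ] H)) :
    matrixOperator (star T) = star (matrixOperator T) := by
  rw [ContinuousLinearMap.star_eq_adjoint, ContinuousLinearMap.eq_adjoint_iff]
  intro x y
  rw [← inner_conj_symm, inner_matrixOperator, inner_matrixOperator]
  simp only [map_sum]
  rw [Finset.sum_comm]
  refine Finset.sum_congr rfl fun i _ => Finset.sum_congr rfl fun j _ => ?_
  rw [Matrix.star_apply, ContinuousLinearMap.star_eq_adjoint,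
    ContinuousLinearMap.adjoint_inner_right, inner_conj_symm]

/-- A representation of a `C⋆`-algebra is completely contractive, since its amplifications are
`⋆`-morphisms of `C⋆`-algebras. -/
theorem norm_matrixOperator_map_le [CompleteSpace H] {B : Type*} [CStarAlgebra B] [PartialOrder B]
    [StarOrderedRing B] (σ : B →⋆ₐ[ℂ] (H →L[ℂ] H)) (M : Matrix (Fin n) (Fin n) B) :
    ‖matrixOperator (M.map σ)‖ ≤ ‖CStarMatrix.ofMatrix M‖ := by
  let Φ : CStarMatrix (Fin n) (Fin n) B →⋆ₙₐ[ℂ]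
      (PiLp 2 (fun _ : Fin n => H) →L[ℂ] PiLp 2 (fun _ : Fin n => H)) :=
    { toFun := fun M => matrixOperator ((CStarMatrix.ofMatrix.symm M).map σ)
      map_smul' := fun c M => by
        rw [← matrixOperator_smul]
        congr 1
        ext1 i j
        exact map_smul σ c (M i j)
      map_zero' := by
        ext x i
        rw [matrixOperator_apply]
        refine Finset.sum_eq_zero fun j _ => ?_
        change σ 0 (x j) = 0
        simp
      map_add' := fun M N => by
        rw [← matrixOperator_add]
        congr 1
        ext1 i j
        exact map_add σ (M i j) (N i j)
      map_mul' := fun M N => by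
        rw [← matrixOperator_mul]
        congr 1
        exact Matrix.map_mul (L := CStarMatrix.ofMatrix.symm M) (M := CStarMatrix.ofMatrix.symm N) (f := σ)
      map_star' := fun M => by
        rw [← matrixOperator_star]
        congr 1
        ext1 i j
        exact map_star σ (M j i) }
  exact NonUnitalStarAlgHom.norm_apply_le Φ (CStarMatrix.ofMatrix M)

end MatrixOperator

section Accretive

variable {B : Type*} [CStarAlgebra B] [PartialOrder B] [StarOrderedRing B]

/-- If `M` has nonnegative real part as an operator on the Hilbert `C⋆`-module of row vectors, then
`‖M - t‖² ≤ ‖M‖² + t²` for `t ≥ 0`. -/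
theorem norm_sub_smul_one_sq_le {n : ℕ} (M : CStarMatrix (Fin n) (Fin n) B)
    (hM : ∀ v : Fin n → B, 0 ≤ (∑ i, ∑ j, v i * M i j * star (v j)) +
      star (∑ i, ∑ j, v i * M i j * star (v j))) (t : ℝ) (ht : 0 ≤ t) :
    ‖M - (t : ℂ) • (1 : CStarMatrix (Fin n) (Fin n) B)‖ ^ 2 ≤ ‖M‖ ^ 2 + t ^ 2 := by
  rw [CStarMatrix.norm_def]
  suffices h : ‖CStarMatrix.toCLM (M - (t : ℂ) • (1 : CStarMatrix (Fin n) (Fin n) B))‖ ≤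
      Real.sqrt (‖M‖ ^ 2 + t ^ 2) by
    have := pow_le_pow_left₀ (ContinuousLinearMap.opNorm_nonneg _) h 2
    rwa [Real.sq_sqrt (by positivity)] at this
  refine ContinuousLinearMap.opNorm_le_bound _ (Real.sqrt_nonneg _) fun v => ?_
  rw [← sq_le_sq₀ (norm_nonneg _) (by positivity), mul_pow, Real.sq_sqrt (by positivity)]
  have hone : CStarMatrix.toCLM (1 : CStarMatrix (Fin n) (Fin n) B) v = v := by
    rw [CStarMatrix.toCLM_apply]
    exact Matrix.vecMul_one v
  set y := CStarMatrix.toCLM M v with hy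
  have happ : CStarMatrix.toCLM (M - (t : ℂ) • (1 : CStarMatrix (Fin n) (Fin n) B)) v =
      y - (t : ℂ) • v := by
    rw [map_sub, map_smul]
    simp [hone, hy]
  rw [happ, CStarModule.norm_sq_eq B]
  have hinner : inner B v y = ∑ i, ∑ j, v i * M i j * star (v j) := by
    rw [hy, CStarMatrix.toCLM_apply_eq_sum, WithCStarModule.pi_inner, Finset.sum_comm]
    simp [WithCStarModule.inner_def, Finset.sum_mul]
  have hpos : 0 ≤ inner B v y + star (inner B v y) := by
    rw [hinner]; exact hM v
  have hle : inner B (y - (t : ℂ) • v) (y - (t : ℂ) • v) ≤ inner B y y + t ^ 2 • inner B v v := by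
    have hexp : inner B y y + t ^ 2 • inner B v v - inner B (y - (t : ℂ) • v) (y - (t : ℂ) • v)
        = t • (inner B v y + star (inner B v y)) := by
      have ht' : ∀ b : B, (t : ℂ) • b = t • b := fun b => Complex.coe_smul t b
      simp only [CStarModule.inner_sub_left, CStarModule.inner_sub_right,
        CStarModule.inner_smul_left_complex, CStarModule.inner_smul_right_complex,
        CStarModule.star_inner, Complex.star_def, Complex.conj_ofReal, ht', smul_add, smul_sub, sq, mul_smul]
      abel
    rw [← sub_nonneg, hexp]
    exact smul_nonneg ht hpos
  calc ‖inner B (y - (t : ℂ) • v) (y - (t : ℂ) • v)‖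
      ≤ ‖inner B y y + t ^ 2 • inner B v v‖ :=
        CStarAlgebra.norm_le_norm_of_nonneg_of_le CStarModule.inner_self_nonneg hle
    _ ≤ ‖inner B y y‖ + t ^ 2 * ‖inner B v v‖ := by
        refine (norm_add_le _ _).trans ?_
        rw [norm_smul, Real.norm_of_nonneg (sq_nonneg t)]
    _ ≤ _ := by
        rw [← CStarModule.norm_sq_eq B, ← CStarModule.norm_sq_eq B, add_mul]
        gcongr
        rw [← mul_pow]
        gcongr
        exact (CStarMatrix.toCLM M).le_opNorm v

/-- A unital completely contractive map sends matrices with nonnegative real part to operators with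
nonnegative real part. -/
theorem re_sum_inner_nonneg_of_completelyContractive {S H : Type*} [AddCommGroup S] [Module ℂ S]
    [NormedAddCommGroup H] [InnerProductSpace ℂ H] (j : S →ₗ[ℂ] B) (ρ : S →ₗ[ℂ] (H →L[ℂ] H)) (e : S)
    (hje : j e = 1) (hρe : ρ e = 1)
    (hcc : ∀ (n : ℕ) (M : Matrix (Fin n) (Fin n) S),
      ‖matrixOperator (M.map ρ)‖ ≤ ‖CStarMatrix.ofMatrix (M.map j)‖)
    {n : ℕ} (M : Matrix (Fin n) (Fin n) S)
    (hM : ∀ v : Fin n → B, 0 ≤ (∑ i, ∑ k, v i * j (M i k) * star (v k)) +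
      star (∑ i, ∑ k, v i * j (M i k) * star (v k))) (x : Fin n → H) :
    0 ≤ (∑ i, ∑ k, ⟪x i, ρ (M i k) (x k)⟫_ℂ).re := by
  classical
  set X : PiLp 2 (fun _ : Fin n => H) := WithLp.toLp 2 x with hX
  set T := matrixOperator (M.map ρ) with hT
  set N := CStarMatrix.ofMatrix (M.map j) with hN
  have hw : (∑ i, ∑ k, ⟪x i, ρ (M i k) (x k)⟫_ℂ) = ⟪X, T X⟫_ℂ := by
    rw [hT, inner_matrixOperator]; rfl
  rw [hw]
  have hbound : ∀ t : ℝ, 0 ≤ t →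
      -(2 * t * (⟪X, T X⟫_ℂ).re) ≤ ‖N‖ ^ 2 * ‖X‖ ^ 2 := by
    intro t ht
    have h1 := norm_sub_smul_one_sq_le N hM t ht
    have h2 := hcc n (M - (t : ℂ) • Matrix.diagonal fun _ => e)
    have e1 : (M - (t : ℂ) • Matrix.diagonal fun _ => e).map ρ =
        M.map ρ + (-(t : ℂ)) • (1 : Matrix (Fin n) (Fin n) (H →L[ℂ] H)) := by
      ext1 i k
      rcases eq_or_ne i k with rfl | h
      · simp [hρe, sub_eq_add_neg]
      · simp [h]
    have e2 : CStarMatrix.ofMatrix ((M - (t : ℂ) • Matrix.diagonal fun _ => e).map j) =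
        N - (t : ℂ) • (1 : CStarMatrix (Fin n) (Fin n) B) := by
      ext i k
      change j (M i k - (t : ℂ) • (Matrix.diagonal fun _ => e) i k) =
        j (M i k) - (t : ℂ) • (1 : Matrix (Fin n) (Fin n) B) i k
      rcases eq_or_ne i k with rfl | h
      · simp [hje]
      · simp [h]
    rw [e1, e2, matrixOperator_add, matrixOperator_smul, matrixOperator_one] at h2
    have h3 : ‖T X - (t : ℂ) • X‖ ≤ ‖N - (t : ℂ) • (1 : CStarMatrix (Fin n) (Fin n) B)‖ * ‖X‖ := by
      have := (T + (-(t : ℂ)) • (1 : PiLp 2 (fun _ : Fin n => H) →L[ℂ] _)).le_of_opNorm_le h2 X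
      simpa [sub_eq_add_neg] using this
    have h4 : ‖T X - (t : ℂ) • X‖ ^ 2 ≤ (‖N‖ ^ 2 + t ^ 2) * ‖X‖ ^ 2 := by
      calc _ ≤ (‖N - (t : ℂ) • (1 : CStarMatrix (Fin n) (Fin n) B)‖ * ‖X‖) ^ 2 := by gcongr
        _ ≤ _ := by rw [mul_pow]; gcongr
    rw [@norm_sub_sq ℂ, inner_smul_right, norm_smul, mul_pow] at h4
    have h5 : RCLike.re ((t : ℂ) * ⟪T X, X⟫_ℂ) = t * (⟪X, T X⟫_ℂ).re := by
      rw [← inner_conj_symm (T X) X]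
      simp only [RCLike.re_eq_complex_re, Complex.re_ofReal_mul, Complex.conj_re]
    rw [h5] at h4
    have h6 : ‖(t : ℂ)‖ ^ 2 = t ^ 2 := by simp
    rw [h6] at h4
    nlinarith [sq_nonneg ‖T X‖]
  -- letting `t` tend to infinity in `hbound` excludes a negative real part
  by_contra hneg
  push Not at hneg
  set r := (⟪X, T X⟫_ℂ).re
  have := hbound ((‖N‖ ^ 2 * ‖X‖ ^ 2 + 1) / (-(2 * r)))
    (div_nonneg (by positivity) (by linarith))
  have hr : -(2 * ((‖N‖ ^ 2 * ‖X‖ ^ 2 + 1) / (-(2 * r))) * r) = ‖N‖ ^ 2 * ‖X‖ ^ 2 + 1 := by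
    have := hneg.ne
    field_simp
  rw [hr] at this
  linarith

end Accretive

/-- **M. Riesz extension along a linear map**: a functional `f` on `X` that is nonnegative on the
preimage of a cone `C` under `J` factors through `J` and a functional nonnegative on `C`, if the
range of `J` dominates the whole space. -/
theorem exists_nonneg_extension {X Y : Type*} [AddCommGroup X] [Module ℝ X] [AddCommGroup Y]
    [Module ℝ Y] (C : PointedCone ℝ Y) (J : X →ₗ[ℝ] Y) (f : X →ₗ[ℝ] ℝ)
    (hf : ∀ x, J x ∈ C → 0 ≤ f x) (hdom : ∀ y, ∃ x, J x + y ∈ C) :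
    ∃ g : Y →ₗ[ℝ] ℝ, (∀ x, g (J x) = f x) ∧ ∀ y ∈ C, 0 ≤ g y := by
  have hker : LinearMap.ker J ≤ LinearMap.ker f := by
    intro x hx
    rw [LinearMap.mem_ker] at hx ⊢
    refine le_antisymm ?_ (hf x (by rw [hx]; exact C.zero_mem))
    have := hf (-x) (by rw [map_neg, hx, neg_zero]; exact C.zero_mem)
    rw [map_neg] at this
    linarith
  let f' : Y →ₗ.[ℝ] ℝ :=
    ⟨LinearMap.range J, (LinearMap.ker J).liftQ f hker ∘ₗ J.quotKerEquivRange.symm.toLinearMap⟩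
  have hf' : ∀ x, f' ⟨J x, LinearMap.mem_range_self J x⟩ = f x := by
    intro x
    change (LinearMap.ker J).liftQ f hker (J.quotKerEquivRange.symm ⟨J x, _⟩) = f x
    rw [LinearMap.quotKerEquivRange_symm_apply_image]
    simp
  obtain ⟨g, hg, hpos⟩ := riesz_extension C f'
    (by
      rintro ⟨_, x, rfl⟩ hx
      rw [hf']
      exact hf x hx)
    (fun y => by
      obtain ⟨x, hx⟩ := hdom y
      exact ⟨⟨J x, LinearMap.mem_range_self J x⟩, hx⟩)
  exact ⟨g, fun x => by rw [← hf' x, ← hg], hpos⟩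

/-! ### Dilation of completely contractive maps -/

/-- The indices that occur in a finitely supported matrix can be enumerated by some `Fin n`. -/
theorem Finsupp.exists_enumeration {ι S : Type*} [AddCommMonoid S] (x : (ι × ι) →₀ S) :
    ∃ (n : ℕ) (f : Fin n → ι), Function.Injective f ∧
      ∀ p ∈ x.support, p ∈ Set.range (Prod.map f f) := by
  classical
  set F : Finset ι := x.support.image Prod.fst ∪ x.support.image Prod.snd with hF
  refine ⟨F.card, fun i => F.equivFin.symm i,
    Subtype.val_injective.comp F.equivFin.symm.injective, fun p hp => ?_⟩
  have h1 : p.1 ∈ F := Finset.mem_union_left _ (Finset.mem_image_of_mem _ hp)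
  have h2 : p.2 ∈ F := Finset.mem_union_right _ (Finset.mem_image_of_mem _ hp)
  exact ⟨(F.equivFin ⟨p.1, h1⟩, F.equivFin ⟨p.2, h2⟩), by simp⟩

theorem Finsupp.sum_eq_sum_enumeration {ι S Z : Type*} [AddCommMonoid S] [AddCommMonoid Z]
    (x : (ι × ι) →₀ S) {n : ℕ} {f : Fin n → ι} (hf : Function.Injective f)
    (hx : ∀ p ∈ x.support, p ∈ Set.range (Prod.map f f)) (g : ι × ι → S → Z)
    (hg : ∀ p, g p 0 = 0) : x.sum g = ∑ i, ∑ k, g (f i, f k) (x (f i, f k)) := by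
  classical
  have hsub : x.support ⊆ Finset.univ.image (Prod.map f f) := fun p hp => by
    obtain ⟨q, hq⟩ := hx p hp
    exact Finset.mem_image.2 ⟨q, Finset.mem_univ _, hq⟩
  rw [Finsupp.sum_of_support_subset x hsub g fun p _ => hg p,
    Finset.sum_image fun a _ b _ h => hf.prodMap hf h, Fintype.sum_prod_type]
  rfl

section Cone

variable {ι B : Type*} [CStarAlgebra B]

/-- The value `∑ i k, v i * x i k * star (v k)` of a finitely supported matrix `x` at the row
vector `v`. Matrices act on row vectors from the right, as in `CStarMatrix.toCLM`. -/
noncomputable def rowForm (v : ι → B) : ((ι × ι) →₀ B) →ₗ[ℂ] B :=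
  Finsupp.lsum ℂ fun p => LinearMap.mulLeft ℂ (v p.1) ∘ₗ LinearMap.mulRight ℂ (star (v p.2))

theorem rowForm_single (v : ι → B) (p : ι × ι) (b : B) :
    rowForm v (Finsupp.single p b) = v p.1 * b * star (v p.2) := by
  simp [rowForm, mul_assoc]

variable [PartialOrder B] [StarOrderedRing B]

/-- The cone of finitely supported matrices over `B` with nonnegative real part. -/
def accretiveCone (ι B : Type*) [CStarAlgebra B] [PartialOrder B] [StarOrderedRing B] :
    PointedCone ℝ ((ι × ι) →₀ B) where
  carrier := {x | ∀ v : ι → B, 0 ≤ rowForm v x + star (rowForm v x)}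
  add_mem' {x y} hx hy v := by
    have : rowForm v (x + y) + star (rowForm v (x + y)) =
        (rowForm v x + star (rowForm v x)) + (rowForm v y + star (rowForm v y)) := by
      rw [map_add, star_add]; abel
    rw [this]
    exact add_nonneg (hx v) (hy v)
  zero_mem' v := by simp
  smul_mem' c x hx v := by
    have : rowForm v (c • x) + star (rowForm v (c • x)) =
        (c : ℝ) • (rowForm v x + star (rowForm v x)) := by
      have hc : c • x = ((c : ℝ) : ℂ) • x := by
        rw [Complex.coe_smul]; rfl
      rw [hc, map_smul, star_smul, smul_add]
      simp
    rw [this]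
    exact smul_nonneg c.2 (hx v)

/-- Every matrix becomes accretive after adding a suitable scalar diagonal matrix. -/
theorem exists_add_mem_accretiveCone {S : Type*} [AddCommGroup S] [Module ℂ S] (j : S →ₗ[ℂ] B)
    (e : S) (hje : j e = 1) (y : (ι × ι) →₀ B) :
    ∃ x : (ι × ι) →₀ S, Finsupp.mapRange.linearMap j x + y ∈ accretiveCone ι B := by
  induction y using Finsupp.induction_linear with
  | zero => exact ⟨0, by simp⟩
  | add y y' hy hy' =>
    obtain ⟨x, hx⟩ := hy
    obtain ⟨x', hx'⟩ := hy'
    refine ⟨x + x', ?_⟩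
    have := (accretiveCone ι B).add_mem hx hx'
    rwa [add_add_add_comm, ← map_add] at this
  | single p a =>
    obtain ⟨i, k⟩ := p
    -- the diagonal entries come from completing the square `(v i + v k a⋆)(v i + v k a⋆)⋆`
    refine ⟨Finsupp.single (i, i) e + Finsupp.single (k, k) (((‖a‖ ^ 2 : ℝ) : ℂ) • e), fun v => ?_⟩
    simp only [map_add, Finsupp.mapRange.linearMap_apply, Finsupp.mapRange_single, map_smul, hje,
      rowForm_single, star_add, star_mul, star_star, star_smul, mul_one, star_one]
    have hle : star a * a ≤ ((‖a‖ ^ 2 : ℝ) : ℂ) • (1 : B) := by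
      have := IsSelfAdjoint.le_algebraMap_norm_self (IsSelfAdjoint.star_mul_self a)
      rwa [CStarRing.norm_star_mul_self, ← sq, Algebra.algebraMap_eq_smul_one,
        ← Complex.coe_smul] at this
    have h1 := mul_star_self_nonneg (v i + v k * star a)
    have h2 := star_right_conjugate_nonneg (sub_nonneg.2 hle) (v k)
    have h3 := mul_star_self_nonneg (v i)
    have h4 : 0 ≤ (‖a‖ ^ 2 : ℝ) • (v k * star (v k)) :=
      smul_nonneg (sq_nonneg _) (mul_star_self_nonneg (v k))
    refine (add_nonneg (add_nonneg h1 h2) (add_nonneg h3 h4)).trans_eq ?_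
    simp only [star_add, star_mul, star_star, mul_sub, sub_mul, mul_add, add_mul, ← mul_assoc,
      mul_smul_comm, smul_mul_assoc, mul_one, Complex.coe_smul,
      Complex.star_def, Complex.conj_ofReal]
    abel

end Cone

/-- **Arveson's extension theorem combined with Stinespring's dilation theorem**: a unital
completely contractive map `ρ : S → B(H)` on a unital subspace `j : S → B` of a `C⋆`-algebra `B`
is the compression of the restriction to `S` of a representation of `B`.

The functional `x ↦ Re ∑ ⟪ξ, ρ (x ξ η) η⟫` on finitely supported matrices over `S`, indexed by the
vectors of `H`, is nonnegative on the accretive ones. Riesz's extension theorem extends it to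
matrices over `B`, and the dilation is read off from the kernel given by its complexification. -/
theorem exists_dilation_of_completelyContractive {B S H : Type*} [CStarAlgebra B] [PartialOrder B]
    [StarOrderedRing B] [AddCommGroup S] [Module ℂ S]
    [NormedAddCommGroup H] [InnerProductSpace ℂ H] (j : S →ₗ[ℂ] B) (ρ : S →ₗ[ℂ] (H →L[ℂ] H)) (e : S)
    (hje : j e = 1) (hρe : ρ e = 1)
    (hcc : ∀ (n : ℕ) (M : Matrix (Fin n) (Fin n) S),
      ‖matrixOperator (M.map ρ)‖ ≤ ‖CStarMatrix.ofMatrix (M.map j)‖) :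
    ∃ (κ : PositiveKernel H B) (θ : B →⋆ₐ[ℂ] (κ.Space →L[ℂ] κ.Space)) (V : H →ₗᵢ[ℂ] κ.Space),
      ∀ s x y, ⟪V x, θ (j s) (V y)⟫_ℂ = ⟪x, ρ s y⟫_ℂ := by
  classical
  let J : ((H × H) →₀ S) →ₗ[ℂ] ((H × H) →₀ B) := Finsupp.mapRange.linearMap j
  let f : ((H × H) →₀ S) →ₗ[ℂ] ℂ :=
    Finsupp.lsum ℂ fun p => (innerSL ℂ p.1).toLinearMap ∘ₗ
      (ContinuousLinearMap.apply ℂ H p.2).toLinearMap ∘ₗ ρ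
  have hf_single : ∀ p s, f (Finsupp.single p s) = ⟪p.1, ρ s p.2⟫_ℂ := fun p s => by simp [f]
  obtain ⟨g, hgJ, hg⟩ := exists_nonneg_extension (accretiveCone H B) (J.restrictScalars ℝ)
    (Complex.reLm ∘ₗ f.restrictScalars ℝ) (by
      intro x hx
      obtain ⟨n, ξ, hξ, hcover⟩ := Finsupp.exists_enumeration x
      have hfx : f x = ∑ i, ∑ k, ⟪ξ i, ρ (x (ξ i, ξ k)) (ξ k)⟫_ℂ :=
        x.sum_eq_sum_enumeration hξ hcover (fun p s => ⟪p.1, ρ s p.2⟫_ℂ) (by simp)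
      change 0 ≤ (f x).re
      rw [hfx]
      refine re_sum_inner_nonneg_of_completelyContractive j ρ e hje hρe hcc
        (fun i k => x (ξ i, ξ k)) (fun v => ?_) ξ
      have hrow := hx (Function.extend ξ v 0)
      have hval : rowForm (Function.extend ξ v 0) (J x) =
          ∑ i, ∑ k, v i * j (x (ξ i, ξ k)) * star (v k) := by
        have h1 : rowForm (Function.extend ξ v 0) (J x) = x.sum fun p s =>
            Function.extend ξ v 0 p.1 * j s * star (Function.extend ξ v 0 p.2) := by
          simp only [J, rowForm, Finsupp.mapRange.linearMap_apply, Finsupp.lsum_apply]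
          rw [Finsupp.sum_mapRange_index (by simp)]
          simp [mul_assoc]
        rw [h1, x.sum_eq_sum_enumeration hξ hcover _ (by simp)]
        simp [hξ.extend_apply]
      change 0 ≤ rowForm (Function.extend ξ v 0) (J x) +
        star (rowForm (Function.extend ξ v 0) (J x)) at hrow
      rwa [hval] at hrow)
    (fun y => exists_add_mem_accretiveCone j e hje y)
  -- matrices without real part are annihilated by `g`
  have hg_skew : ∀ x, (∀ v, rowForm v x + star (rowForm v x) = 0) → g x = 0 := by
    intro x hx
    refine le_antisymm ?_ (hg x fun v => (hx v).ge)
    have := hg (-x) fun v => by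
      rw [map_neg, star_neg, ← neg_add, hx v, neg_zero]
    rw [map_neg] at this
    linarith
  let F : ((H × H) →₀ B) →ₗ[ℂ] ℂ := Module.Dual.extendRCLike g
  have hF : ∀ x, F x = (g x : ℂ) - Complex.I * (g (Complex.I • x) : ℂ) := fun x =>
    Module.Dual.extendRCLike_apply g x
  have hFJ : ∀ x, F (J x) = f x := by
    intro x
    have h1 : g (J x) = (f x).re := hgJ x
    have h2 : g (Complex.I • J x) = (f (Complex.I • x)).re := by
      rw [← map_smul]; exact hgJ (Complex.I • x)
    rw [hF, h1, h2, map_smul]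
    apply Complex.ext <;> simp
  have hF_nonneg : ∀ u : H →₀ B,
      0 ≤ u.sum fun x a => u.sum fun y b => F (Finsupp.single (x, y) (star a * b)) := by
    intro u
    set z : (H × H) →₀ B := u.sum fun x a => u.sum fun y b => Finsupp.single (x, y) (star a * b)
    have hz : (u.sum fun x a => u.sum fun y b => F (Finsupp.single (x, y) (star a * b))) = F z := by
      simp only [z, Finsupp.sum, map_sum]
    have hrow : ∀ v : H → B, rowForm v z = (u.sum fun x a => v x * star a) *
        star (u.sum fun x a => v x * star a) := by
      intro v
      simp only [z, Finsupp.sum, map_sum, rowForm_single, star_sum, star_mul, star_star,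
        Finset.sum_mul_sum, mul_assoc]
    have h1 : 0 ≤ g z := hg z fun v => by
      rw [hrow, star_mul, star_star]
      exact add_nonneg (mul_star_self_nonneg _) (mul_star_self_nonneg _)
    have h2 : g (Complex.I • z) = 0 := hg_skew _ fun v => by
      rw [map_smul, hrow, star_smul, star_mul, star_star]
      simp
    rw [hz, hF, h2]
    simpa using h1
  let κ : PositiveKernel H B := ⟨fun x y => F ∘ₗ Finsupp.lsingle (x, y), hF_nonneg⟩
  have hκ : ∀ x y s, κ.toFun x y (j s) = ⟪x, ρ s y⟫_ℂ := by
    intro x y s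
    have : Finsupp.single (x, y) (j s) = J (Finsupp.single (x, y) s) := by simp [J]
    change F (Finsupp.single (x, y) (j s)) = _
    rw [this, hFJ, hf_single]
  obtain ⟨θ, V, hV⟩ := κ.exists_dilation fun x y => by
    rw [← hje, hκ, hρe, one_apply_eq_self]
  exact ⟨κ, θ, V, fun s x y => by rw [hV, hκ]⟩

/-! ### Compressions of representations -/

theorem ContinuousLinearMap.opNorm_le_of_inner_le {E : Type*} [NormedAddCommGroup E]
    [InnerProductSpace ℂ E] (T : E →L[ℂ] E) {C : ℝ} (hC : 0 ≤ C)
    (h : ∀ x y, ‖⟪x, T y⟫_ℂ‖ ≤ ‖x‖ * (C * ‖y‖)) : ‖T‖ ≤ C := by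
  refine T.opNorm_le_bound hC fun y => ?_
  by_contra! hlt
  have h2 : 0 < ‖T y‖ := lt_of_le_of_lt (by positivity) hlt
  have h1 := h (T y) y
  rw [inner_self_eq_norm_sq_to_K, norm_pow, RCLike.norm_ofReal, abs_norm, sq] at h1
  exact absurd (le_of_mul_le_mul_left h1 h2) (not_le.2 hlt)

section Compression

variable {A H K : Type*} [Ring A] [StarRing A] [Algebra ℂ A]
  [NormedAddCommGroup H] [InnerProductSpace ℂ H] [CompleteSpace H]
  [NormedAddCommGroup K] [InnerProductSpace ℂ K] [CompleteSpace K]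

/-- The compression `a ↦ V⋆ σ(a) V` of a representation along an isometry. -/
noncomputable def compression (σ : A →⋆ₐ[ℂ] (K →L[ℂ] K)) (V : H →ₗᵢ[ℂ] K) :
    A →ₗ[ℂ] (H →L[ℂ] H) where
  toFun a := ContinuousLinearMap.adjoint V.toContinuousLinearMap ∘L σ a ∘L V.toContinuousLinearMap
  map_add' a b := by ext x; simp
  map_smul' c a := by ext x; simp

variable (σ : A →⋆ₐ[ℂ] (K →L[ℂ] K)) (V : H →ₗᵢ[ℂ] K)

theorem inner_compression (a : A) (x y : H) :
    ⟪x, compression σ V a y⟫_ℂ = ⟪V x, σ a (V y)⟫_ℂ := by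
  simp [compression, ContinuousLinearMap.adjoint_inner_right]

theorem eq_compression_iff {ψ : A →ₗ[ℂ] (H →L[ℂ] H)} {a : A} :
    ψ a = compression σ V a ↔ ∀ x y, ⟪x, ψ a y⟫_ℂ = ⟪V x, σ a (V y)⟫_ℂ := by
  refine ⟨fun h x y => by rw [h, inner_compression], fun h => ?_⟩
  ext y
  refine ext_inner_left ℂ fun x => ?_
  rw [h, inner_compression]

theorem compression_one : compression σ V 1 = 1 := by
  ext y
  refine ext_inner_left ℂ fun x => ?_
  rw [inner_compression, map_one, one_apply_eq_self, one_apply_eq_self, V.inner_map_map]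

theorem norm_compression_le (a : A) : ‖compression σ V a‖ ≤ ‖σ a‖ := by
  refine ContinuousLinearMap.opNorm_le_of_inner_le _ (norm_nonneg _) fun x y => ?_
  rw [inner_compression, ← V.norm_map x, ← V.norm_map y]
  exact (norm_inner_le_norm _ _).trans (by gcongr; exact (σ a).le_opNorm _)

theorem norm_matrixOperator_compression_le {n : ℕ} (M : Matrix (Fin n) (Fin n) A) :
    ‖matrixOperator (M.map (compression σ V))‖ ≤ ‖matrixOperator (M.map σ)‖ := by
  refine ContinuousLinearMap.opNorm_le_of_inner_le _ (norm_nonneg _) fun X Y => ?_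
  let W : PiLp 2 (fun _ : Fin n => H) → PiLp 2 (fun _ : Fin n => K) :=
    fun X => WithLp.toLp 2 fun i => V (X i)
  have hW : ∀ X, ‖W X‖ = ‖X‖ := fun X => by simp [W, PiLp.norm_eq_of_L2]
  have hinner : ⟪X, matrixOperator (M.map (compression σ V)) Y⟫_ℂ =
      ⟪W X, matrixOperator (M.map σ) (W Y)⟫_ℂ := by
    rw [inner_matrixOperator, inner_matrixOperator]
    simp [inner_compression, W]
  rw [hinner, ← hW X, ← hW Y]
  exact (norm_inner_le_norm _ _).trans (by gcongr; exact ContinuousLinearMap.le_opNorm _ _)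

theorem compression_star (a : A) : compression σ V (star a) = star (compression σ V a) := by
  ext y
  refine ext_inner_left ℂ fun x => ?_
  rw [inner_compression, map_star, ContinuousLinearMap.star_eq_adjoint,
    ContinuousLinearMap.star_eq_adjoint, ContinuousLinearMap.adjoint_inner_right,
    ContinuousLinearMap.adjoint_inner_right, ← inner_conj_symm, ← inner_compression,
    inner_conj_symm]

/-- On vectors that `σ a` keeps in the range of `V`, the compression intertwines. -/
theorem apply_eq_compression {a : A} {y : H} (h : σ a (V y) ∈ Set.range V) :
    V (compression σ V a y) = σ a (V y) := by
  obtain ⟨z, hz⟩ := h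
  rw [← hz]
  congr 1
  refine ext_inner_left ℂ fun x => ?_
  rw [inner_compression, ← hz, V.inner_map_map]

theorem compression_mul (hV : ∀ a y, σ a (V y) ∈ Set.range V) (a b : A) :
    compression σ V (a * b) = compression σ V a * compression σ V b := by
  ext y
  apply V.injective
  rw [mul_apply_eq_comp, apply_eq_compression σ V (hV _ _), apply_eq_compression σ V (hV _ _),
    apply_eq_compression σ V (hV _ _), map_mul, mul_apply_eq_comp]

/-- If the compression of a representation is itself a `⋆`-morphism, then the range of the
isometry is invariant and the compression intertwines. -/
theorem apply_eq_of_compression_eq {π : A →ₗ[ℂ] (H →L[ℂ] H)}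
    (hmul : ∀ a b, π (a * b) = π a * π b) (hstar : ∀ a, π (star a) = star (π a))
    (h : compression σ V = π) (a : A) (y : H) : σ a (V y) = V (π a y) := by
  have hin : ∀ a x y, ⟪V x, σ a (V y)⟫_ℂ = ⟪x, π a y⟫_ℂ := fun a x y => by
    rw [← inner_compression, h]
  have hin' : ⟪σ a (V y), σ a (V y)⟫_ℂ = ⟪π a y, π a y⟫_ℂ := by
    have h1 := hin (star a * a) y y
    rwa [map_mul, map_star, hmul, hstar, mul_apply_eq_comp, mul_apply_eq_comp,
      ContinuousLinearMap.star_eq_adjoint, ContinuousLinearMap.star_eq_adjoint,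
      ContinuousLinearMap.adjoint_inner_right, ContinuousLinearMap.adjoint_inner_right] at h1
  rw [← sub_eq_zero, ← inner_self_eq_zero (𝕜 := ℂ)]
  have h2 : ⟪σ a (V y), V (π a y)⟫_ℂ = ⟪π a y, π a y⟫_ℂ := by
    rw [← inner_conj_symm, hin, inner_conj_symm]
  rw [inner_sub_left, inner_sub_right, inner_sub_right, hin', h2, hin, V.inner_map_map]
  simp

theorem matrixSeminorm_eq_zero_iff [StarModule ℂ A] (p : CStarSeminorm A) {n : ℕ}
    (M : Matrix (Fin n) (Fin n) A) : p.matrixSeminorm M = 0 ↔ ∀ i k, p (M i k) = 0 := by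
  unfold CStarSeminorm.matrixSeminorm
  rw [norm_eq_zero]
  constructor
  · intro h i k
    have : p.proj (M i k) = 0 := congrFun (congrFun h i) k
    rw [← p.norm_toQuotient]
    exact norm_eq_zero.2 this
  · intro h
    ext i k
    change p.toQuotient (M i k) = 0
    rw [← norm_eq_zero, p.norm_toQuotient, h]

/-- Compressions of local representations are local completely positive. -/
theorem isLocalCP_compression [StarModule ℂ A] {Λ : Type*} (p : Λ → CStarSeminorm A) (l : Λ)
    (hσ : ∀ a, ‖σ a‖ ≤ p l a) : IsLocalCP p (compression σ V) := by
  have hnull : ∀ a, p l a = 0 → σ a = 0 := fun a ha =>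
    norm_le_zero_iff.1 ((hσ a).trans ha.le)
  refine ⟨l, fun n M => ⟨?_, fun hM => ?_⟩⟩
  · rintro ⟨b, c, rfl, hc⟩
    rw [matrixSeminorm_eq_zero_iff] at hc
    have hval : ∀ X : PiLp 2 (fun _ : Fin n => H),
        ⟪X, matrixOperator ((star b * b + c).map (compression σ V)) X⟫_ℂ =
          ∑ m, ⟪∑ i, σ (b m i) (V (X i)), ∑ i, σ (b m i) (V (X i))⟫_ℂ := by
      intro X
      have hentry : ∀ i k, ⟪X i, compression σ V ((star b * b + c) i k) (X k)⟫_ℂ =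
          ∑ m, ⟪σ (b m i) (V (X i)), σ (b m k) (V (X k))⟫_ℂ := by
        intro i k
        rw [inner_compression, Matrix.add_apply, map_add, hnull _ (hc i k), add_zero,
          Matrix.mul_apply, map_sum, sum_apply, inner_sum]
        refine Finset.sum_congr rfl fun m _ => ?_
        rw [map_mul, Matrix.star_apply, map_star, mul_apply_eq_comp,
          ContinuousLinearMap.star_eq_adjoint, ContinuousLinearMap.adjoint_inner_right]
      rw [inner_matrixOperator]
      simp only [Matrix.map_apply, hentry, sum_inner, inner_sum]
      calc _ = ∑ i, ∑ m, ∑ k, ⟪σ (b m i) (V (X i)), σ (b m k) (V (X k))⟫_ℂ :=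
            Finset.sum_congr rfl fun i _ => Finset.sum_comm
        _ = ∑ m, ∑ i, ∑ k, ⟪σ (b m i) (V (X i)), σ (b m k) (V (X k))⟫_ℂ := Finset.sum_comm
        _ = _ := Finset.sum_congr rfl fun m _ => Finset.sum_comm
    have hnonneg : ∀ X : PiLp 2 (fun _ : Fin n => H),
        0 ≤ ⟪X, matrixOperator ((star b * b + c).map (compression σ V)) X⟫_ℂ := fun X => by
      rw [hval]
      exact Finset.sum_nonneg fun m _ =>
        Complex.nonneg_iff.2 ⟨inner_self_nonneg (𝕜 := ℂ), (inner_self_im (𝕜 := ℂ) _).symm⟩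
    rw [ContinuousLinearMap.isPositive_iff_complex]
    intro X
    obtain ⟨h1, h2⟩ := Complex.nonneg_iff.1 (hnonneg X)
    have hconj := (inner_conj_symm (𝕜 := ℂ) (matrixOperator ((star b * b + c).map (compression σ V)) X) X).symm
    generalize ⟪X, matrixOperator ((star b * b + c).map (compression σ V)) X⟫_ℂ = z at h1 h2 hconj
    rw [hconj]
    exact ⟨Complex.ext (by simp) (by simp [← h2]), by simpa using h1⟩
  · rw [matrixSeminorm_eq_zero_iff] at hM
    ext i k y
    refine ext_inner_left ℂ fun x => ?_
    rw [Matrix.map_apply, inner_compression, hnull _ (hM i k)]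
    simp

end Compression

section Stinespring

variable {A H Λ : Type*} [Ring A] [StarRing A] [Algebra ℂ A] [StarModule ℂ A]
  [NormedAddCommGroup H] [InnerProductSpace ℂ H]

/-- Complete positivity as positive definiteness of the kernel `⟪x, ψ (star a * b) y⟫`. -/
theorem IsLocalCP.sum_inner_nonneg {p : Λ → CStarSeminorm A} {ψ : A →ₗ[ℂ] (H →L[ℂ] H)}
    (hψ : IsLocalCP p ψ) {n : ℕ} (a : Fin n → A) (x : Fin n → H) :
    0 ≤ ∑ i, ∑ k, ⟪x i, ψ (star (a i) * a k) (x k)⟫_ℂ := by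
  obtain ⟨l, hl⟩ := hψ
  -- with all rows of `b` equal to `a`, the entries of `star b * b` are `n` times the wanted ones
  let b : Matrix (Fin n) (Fin n) A := fun _ k => a k
  have hpos := (hl n (star b * b)).1
    ⟨b, 0, (add_zero _).symm, (matrixSeminorm_eq_zero_iff _ _).2 fun i k => map_zero _⟩
  have h := hpos.inner_nonneg_right (WithLp.toLp 2 x)
  have hentry : ∀ i k, (star b * b) i k = n • (star (a i) * a k) := fun i k => by
    rw [Matrix.mul_apply]
    change ∑ _ : Fin n, star (a i) * a k = _
    rw [Finset.sum_const, Finset.card_univ, Fintype.card_fin]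
  rw [inner_matrixOperator] at h
  simp only [Matrix.map_apply, hentry, map_nsmul, smul_apply] at h
  rcases Nat.eq_zero_or_pos n with rfl | hn
  · simp
  · have h' : 0 ≤ (n : ℂ) * ∑ i, ∑ k, ⟪x i, ψ (star (a i) * a k) (x k)⟫_ℂ := by
      simpa [Finset.mul_sum, ← Nat.cast_smul_eq_nsmul ℂ, inner_smul_right] using h
    have hn' : (0 : ℂ) ≤ ((n : ℝ)⁻¹ : ℝ) := Complex.zero_le_real.2 (by positivity)
    have hn0 : (n : ℂ) ≠ 0 := Nat.cast_ne_zero.2 hn.ne'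
    simpa [hn0] using mul_nonneg hn' h'

/-- **Stinespring's theorem** for a unital local completely positive map bounded by a
`C⋆`-seminorm `p l`: it is a compression of a representation of the `C⋆`-algebra of `p l`. The index
that witnesses complete positivity need not be `l`: only the positivity of `ψ` on `star b * b` is used,
and the bound carries it over to the `C⋆`-algebra of `p l`. -/
theorem IsLocalCP.exists_dilation [CompleteSpace H] {p : Λ → CStarSeminorm A} {l : Λ}
    {ψ : A →ₗ[ℂ] (H →L[ℂ] H)} (hψ : IsLocalCP p ψ) (hone : ψ 1 = 1) (hb : ∀ a, ‖ψ a‖ ≤ p l a) :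
    ∃ (κ : PositiveKernel H (p l).QuotientAlgebra)
      (θ : (p l).QuotientAlgebra →⋆ₐ[ℂ] (κ.Space →L[ℂ] κ.Space)) (V : H →ₗᵢ[ℂ] κ.Space),
      ψ = compression (θ.comp (p l).proj) V := by
  let pr : A →ₗ[ℂ] (p l).QuotientAlgebra := ((p l).proj : A →ₐ[ℂ] _).toLinearMap
  -- extend `ψ` to the completion; positivity passes to the limit, so no square roots are lifted
  let Ψ : (p l).QuotientAlgebra →L[ℂ] (H →L[ℂ] H) := ψ.extendOfNorm pr
  have hdense : DenseRange (p l).proj := (p l).denseRange_toQuotient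
  have hΨ : ∀ a, Ψ ((p l).proj a) = ψ a := fun a =>
    LinearMap.extendOfNorm_eq (f := ψ) (e := pr) hdense
      ⟨1, fun x => by rw [one_mul]; exact (hb x).trans_eq ((p l).norm_toQuotient x).symm⟩ a
  have hpos : ∀ {n : ℕ} (w : Fin n → (p l).QuotientAlgebra) (x : Fin n → H),
      0 ≤ ∑ i, ∑ k, ⟪x i, Ψ (star (w i) * w k) (x k)⟫_ℂ := by
    intro n w x
    have hd : DenseRange (Pi.map fun _ : Fin n => (p l).proj) := DenseRange.piMap fun _ => hdense
    have hstar := (p l).continuous_star_quotient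
    refine hd.induction_on w (isClosed_le continuous_const ?_) fun a => ?_
    · refine continuous_finsetSum _ fun i _ => continuous_finsetSum _ fun k _ => ?_
      have h1 : Continuous fun w : Fin n → (p l).QuotientAlgebra => star (w i) * w k :=
        (hstar.comp (continuous_apply i)).mul (continuous_apply k)
      exact continuous_const.inner ((Ψ.continuous.comp h1).clm_apply continuous_const)
    · simpa only [Pi.map_apply, ← map_star, ← map_mul, hΨ] using hψ.sum_inner_nonneg a x
  let κ : PositiveKernel H (p l).QuotientAlgebra :=
    { toFun := fun x y => (innerSL ℂ x).toLinearMap ∘ₗ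
        (ContinuousLinearMap.apply ℂ H y).toLinearMap ∘ₗ Ψ.toLinearMap
      nonneg' := fun u => by
        have hre : ∀ h : H → ℂ, ∑ x ∈ u.support, h x =
            ∑ i : Fin u.support.card, h (u.support.equivFin.symm i) := fun h => by
          rw [← Finset.sum_coe_sort u.support h]
          exact (Equiv.sum_comp u.support.equivFin.symm fun i : u.support => h i).symm
        simp only [Finsupp.sum, hre]
        exact hpos (fun i => u (u.support.equivFin.symm i)) fun i => u.support.equivFin.symm i }
  have hκ : ∀ x y b, κ.toFun x y b = ⟪x, Ψ b y⟫_ℂ := fun x y b => rfl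
  obtain ⟨θ, V, hV⟩ := κ.exists_dilation fun x y => by
    rw [hκ, ← map_one (p l).proj, hΨ, hone, one_apply_eq_self]
  refine ⟨κ, θ, V, LinearMap.ext fun a => (eq_compression_iff _ _).2 fun x y => ?_⟩
  rw [StarAlgHom.comp_apply, hV, hκ, hΨ]

end Stinespring

/-! ### Unique extension and invariance under complete isometries -/

section UniqueExtension

/-- If `π` is the only unital local completely positive extension of `π|_S` with bound `p l`, then
every dilation `V⋆ σ(·) V` of `π|_S`, through any completely contractive map `j₂` of `S` into a
`C⋆`-algebra represented by `σ`, is trivial: `V` intertwines `π|_S` with `σ ∘ j₂`.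

Indeed `σ ∘ j₂` has itself a dilation `W⋆ θ(·) W` with a representation `θ` of `A`. The
compression of `θ` along `W V` extends `π|_S`, so it is the `⋆`-morphism `π`, hence `W V` intertwines
`π` with `θ`; compressing by `W` gives the claim. -/
theorem apply_eq_of_unique_extension {A B₂ Λ H K : Type*} [Ring A] [StarRing A] [Algebra ℂ A]
    [StarModule ℂ A] [CStarAlgebra B₂] [PartialOrder B₂] [StarOrderedRing B₂]
    [NormedAddCommGroup H] [InnerProductSpace ℂ H] [CompleteSpace H]
    [NormedAddCommGroup K] [InnerProductSpace ℂ K] [CompleteSpace K]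
    {p : Λ → CStarSeminorm A} {l : Λ} {S : Submodule ℂ A} (h1S : (1 : A) ∈ S)
    {π : A →ₗ[ℂ] (H →L[ℂ] H)} (hπ : IsLocalRepresentation p π)
    (huniq : ∀ ψ : A →ₗ[ℂ] (H →L[ℂ] H), IsUnitalLocalCPExtension p S l π ψ → ψ = π)
    (j₂ : S →ₗ[ℂ] B₂) (hj₂ : j₂ ⟨1, h1S⟩ = 1)
    (hcc : ∀ (n : ℕ) (M : Matrix (Fin n) (Fin n) S),
      ‖CStarMatrix.ofMatrix (M.map j₂)‖ ≤ (p l).matrixSeminorm (M.map fun s => (s : A)))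
    (σ : B₂ →⋆ₐ[ℂ] (K →L[ℂ] K)) (V : H →ₗᵢ[ℂ] K)
    (hV : ∀ (s : S) x y, ⟪V x, σ (j₂ s) (V y)⟫_ℂ = ⟪x, π s y⟫_ℂ) (s : S) (y : H) :
    σ (j₂ s) (V y) = V (π s y) := by
  obtain ⟨κ, θ, W, hW⟩ := exists_dilation_of_completelyContractive
    (((p l).proj : A →ₐ[ℂ] (p l).QuotientAlgebra).toLinearMap ∘ₗ S.subtype)
    ((σ : B₂ →ₐ[ℂ] (K →L[ℂ] K)).toLinearMap ∘ₗ j₂) ⟨1, h1S⟩ (map_one (p l).proj)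
    (by simp [hj₂])
    (fun n M => (norm_matrixOperator_map_le σ (M.map j₂)).trans (hcc n M))
  replace hW : ∀ (s : S) x y, ⟪W x, θ ((p l).proj s) (W y)⟫_ℂ = ⟪x, σ (j₂ s) y⟫_ℂ := hW
  have hbound : ∀ a, ‖θ.comp (p l).proj a‖ ≤ p l a := fun a =>
    (NonUnitalStarAlgHom.norm_apply_le θ _).trans_eq ((p l).norm_toQuotient a)
  have hcomp : compression (θ.comp (p l).proj) (W.comp V) = π := huniq _
    { map_one := compression_one _ _
      localCP := isLocalCP_compression _ _ p l hbound
      eqOn := fun s hs => by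
        refine ((eq_compression_iff _ _).2 fun x y => ?_).symm
        exact ((hW ⟨s, hs⟩ _ _).trans (hV ⟨s, hs⟩ x y)).symm
      bound := fun a => (norm_compression_le _ _ a).trans (hbound a) }
  have hint := apply_eq_of_compression_eq _ _ hπ.map_mul hπ.map_star hcomp (s : A) y
  refine ext_inner_left ℂ fun k => ?_
  rw [← hW]
  change θ ((p l).proj s) (W (V y)) = W (V (π s y)) at hint
  rw [hint, W.inner_map_map]

end UniqueExtension

section Generation

variable {A Λ : Type*} [Ring A] [StarRing A] [Algebra ℂ A] [UniformSpace A]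

theorem IsLocallyCStarAlgebra.continuous_of_norm_le [Preorder Λ] {p : Λ → CStarSeminorm A}
    (hA : IsLocallyCStarAlgebra p) {E : Type*} [NormedAddCommGroup E] [NormedSpace ℂ E]
    (f : A →ₗ[ℂ] E) (l : Λ) (hf : ∀ a, ‖f a‖ ≤ p l a) : Continuous f := by
  refine hA.withSeminorms.continuous_normedSpace_rng E f ⟨{l}, 1, fun a => ?_⟩
  simpa using hf a

variable [StarModule ℂ A]

/-- Induction for a closed property of the elements of an algebra generated by a self-adjoint
subspace; as the subspace is self-adjoint, the involution need not be considered. -/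
theorem GeneratesLocallyCStar.induction {S : Submodule ℂ A} (hgen : GeneratesLocallyCStar S)
    (hS : IsLocalOperatorSystem S) {P : A → Prop} (hclosed : IsClosed {a | P a})
    (mem : ∀ s ∈ S, P s) (add : ∀ a b, P a → P b → P (a + b))
    (mul : ∀ a b, P a → P b → P (a * b)) (a : A) : P a := by
  refine Dense.induction hgen (fun b hb => ?_) hclosed a
  have hscalar : ∀ c : ℂ, P (algebraMap ℂ A c) := fun c => mem _ (by
    rw [Algebra.algebraMap_eq_smul_one]
    exact S.smul_mem c hS.one_mem)
  suffices h : P b ∧ P (star b) from h.1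
  induction hb using StarAlgebra.adjoin_induction with
  | mem s hs => exact ⟨mem s hs, mem _ (hS.star_mem s hs)⟩
  | algebraMap c => exact ⟨hscalar c, by rw [← algebraMap_star_comm]; exact hscalar _⟩
  | add x y _ _ hx hy => exact ⟨add _ _ hx.1 hy.1, by rw [star_add]; exact add _ _ hx.2 hy.2⟩
  | mul x y _ _ hx hy => exact ⟨mul _ _ hx.1 hy.1, by rw [star_mul]; exact mul _ _ hy.2 hx.2⟩
  | star x _ hx => exact ⟨hx.2, by rw [star_star]; exact hx.1⟩

/-- Bounded multiplicative maps are determined by their restriction to generators. -/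
theorem eq_of_eqOn_generators [Preorder Λ] {p : Λ → CStarSeminorm A}
    (hA : IsLocallyCStarAlgebra p) {S : Submodule ℂ A} (hgen : GeneratesLocallyCStar S)
    (hS : IsLocalOperatorSystem S) {H : Type*} [NormedAddCommGroup H] [InnerProductSpace ℂ H]
    {π ψ : A →ₗ[ℂ] (H →L[ℂ] H)} {l : Λ} (hπ : ∀ a, ‖π a‖ ≤ p l a) (hψ : ∀ a, ‖ψ a‖ ≤ p l a)
    (hπ_mul : ∀ a b, π (a * b) = π a * π b) (hψ_mul : ∀ a b, ψ (a * b) = ψ a * ψ b)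
    (h : ∀ s ∈ S, ψ s = π s) : ψ = π := by
  ext1 a
  refine hgen.induction hS (P := fun a => ψ a = π a) ?_ h ?_ ?_ a
  · exact isClosed_eq (hA.continuous_of_norm_le ψ l hψ) (hA.continuous_of_norm_le π l hπ)
  · intro a b ha hb
    rw [map_add, map_add, ha, hb]
  · intro a b ha hb
    rw [hψ_mul, hπ_mul, ha, hb]

/-- A closed subspace, given as the range of an isometry, that is invariant under generators is
invariant under the whole algebra. -/
theorem mem_range_of_mem_range_generators [Preorder Λ] {p : Λ → CStarSeminorm A}
    (hA : IsLocallyCStarAlgebra p) {S : Submodule ℂ A} (hgen : GeneratesLocallyCStar S)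
    (hS : IsLocalOperatorSystem S) {H K : Type*} [NormedAddCommGroup H] [InnerProductSpace ℂ H]
    [CompleteSpace H] [NormedAddCommGroup K] [InnerProductSpace ℂ K] [CompleteSpace K] {l : Λ}
    (σ : A →⋆ₐ[ℂ] (K →L[ℂ] K)) (hσ : ∀ a, ‖σ a‖ ≤ p l a) (V : H →ₗᵢ[ℂ] K)
    (h : ∀ s ∈ S, ∀ y, σ s (V y) ∈ Set.range V) (a : A) (y : H) : σ a (V y) ∈ Set.range V := by
  have hcont : Continuous σ :=
    hA.continuous_of_norm_le (σ : A →ₐ[ℂ] (K →L[ℂ] K)).toLinearMap l hσ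
  have hrange : IsClosed (Set.range V) := V.isometry.isClosedEmbedding.isClosed_range
  refine hgen.induction hS (P := fun a => ∀ y, σ a (V y) ∈ Set.range V) ?_ h ?_ ?_ a y
  · rw [Set.ofPred_forall]
    exact isClosed_iInter fun y => hrange.preimage (hcont.clm_apply continuous_const)
  · intro a b ha hb y
    obtain ⟨u, hu⟩ := ha y
    obtain ⟨v, hv⟩ := hb y
    exact ⟨u + v, by rw [map_add, map_add, hu, hv, add_apply]⟩
  · intro a b ha hb y
    obtain ⟨v, hv⟩ := hb y
    rw [map_mul, mul_apply_eq_comp, ← hv]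
    exact ha v

end Generation

theorem propositionB {A₁ A₂ Λ H : Type*}
    [Ring A₁] [StarRing A₁] [Algebra ℂ A₁] [StarModule ℂ A₁] [UniformSpace A₁]
    [Ring A₂] [StarRing A₂] [Algebra ℂ A₂] [StarModule ℂ A₂] [UniformSpace A₂]
    [Preorder Λ]
    [NormedAddCommGroup H] [InnerProductSpace ℂ H] [CompleteSpace H]
    (p : Λ → CStarSeminorm A₁) (q : Λ → CStarSeminorm A₂)
    (hA₁ : IsLocallyCStarAlgebra p) (hA₂ : IsLocallyCStarAlgebra q)
    (S₁ : Submodule ℂ A₁) (S₂ : Submodule ℂ A₂)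
    (hS₁ : IsLocalOperatorSystem S₁) (hS₂ : IsLocalOperatorSystem S₂)
    (hgen₁ : GeneratesLocallyCStar S₁) (hgen₂ : GeneratesLocallyCStar S₂)
    (φ : S₁ →ₗ[ℂ] S₂) (hφ_surj : Function.Surjective φ)
    (hφ_unital : φ ⟨1, hS₁.one_mem⟩ = ⟨1, hS₂.one_mem⟩)
    (hφ_iso : IsLocalCompletelyIsometric p q φ)
    (π₁ : A₁ →ₗ[ℂ] (H →L[ℂ] H)) (hπ₁ : IsAdmissibleLocalBoundaryRep p S₁ π₁) :
    ∃ π₂ : A₂ →ₗ[ℂ] (H →L[ℂ] H),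
      IsAdmissibleLocalBoundaryRep q S₂ π₂ ∧ ∀ s : S₁, π₂ (φ s : A₂) = π₁ (s : A₁) := by
  obtain ⟨l, hext, huniq⟩ := hπ₁.unique
  let j₂ : S₁ →ₗ[ℂ] (q l).QuotientAlgebra :=
    ((q l).proj : A₂ →ₐ[ℂ] (q l).QuotientAlgebra).toLinearMap ∘ₗ S₂.subtype ∘ₗ φ
  have hj₂ : ∀ s, j₂ s = (q l).proj (φ s : A₂) := fun _ => rfl
  have hj₂_one : j₂ ⟨1, hS₁.one_mem⟩ = 1 := by
    rw [hj₂, hφ_unital]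
    exact map_one (q l).proj
  have hbound : ∀ {K : Type _} [NormedAddCommGroup K] [InnerProductSpace ℂ K] [CompleteSpace K]
      (θ : (q l).QuotientAlgebra →⋆ₐ[ℂ] (K →L[ℂ] K)) (a : A₂),
      ‖θ.comp (q l).proj a‖ ≤ q l a := fun θ a =>
    (NonUnitalStarAlgHom.norm_apply_le θ _).trans_eq ((q l).norm_toQuotient a)
  -- dilations of `π₁ ∘ φ⁻¹` leave the range of the isometry invariant
  have hinv : ∀ {K : Type _} [NormedAddCommGroup K] [InnerProductSpace ℂ K] [CompleteSpace K]
      (θ : (q l).QuotientAlgebra →⋆ₐ[ℂ] (K →L[ℂ] K)) (V : H →ₗᵢ[ℂ] K),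
      (∀ (s : S₁) x y, ⟪V x, θ (j₂ s) (V y)⟫_ℂ = ⟪x, π₁ s y⟫_ℂ) →
      ∀ a y, θ.comp (q l).proj a (V y) ∈ Set.range V := by
    intro K _ _ _ θ V hV
    refine mem_range_of_mem_range_generators hA₂ hgen₂ hS₂ _ (hbound θ) V fun s hs y => ?_
    obtain ⟨s₁, hs₁⟩ := hφ_surj ⟨s, hs⟩
    have := apply_eq_of_unique_extension hS₁.one_mem hπ₁.localRep huniq j₂ hj₂_one
      (fun n M => (hφ_iso l n M).le) θ V hV s₁ y
    rw [hj₂, hs₁] at this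
    exact ⟨_, this.symm⟩
  -- `π₁` is completely contractive, being a compression of a representation
  obtain ⟨κ₁, θ₁, V₁, hθ₁⟩ := hext.localCP.exists_dilation hext.map_one hext.bound
  have hcc : ∀ (n : ℕ) (M : Matrix (Fin n) (Fin n) S₁),
      ‖matrixOperator (M.map (π₁ ∘ₗ S₁.subtype))‖ ≤ ‖CStarMatrix.ofMatrix (M.map j₂)‖ := by
    intro n M
    have h1 : M.map (π₁ ∘ₗ S₁.subtype) =
        (M.map fun s => (s : A₁)).map (compression (θ₁.comp (p l).proj) V₁) := by
      rw [← hθ₁]; rfl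
    rw [h1]
    exact (norm_matrixOperator_compression_le _ _ _).trans
      ((norm_matrixOperator_map_le θ₁ _).trans (hφ_iso l n M).ge)
  obtain ⟨κ, θ, V, hV⟩ := exists_dilation_of_completelyContractive j₂ (π₁ ∘ₗ S₁.subtype)
    ⟨1, hS₁.one_mem⟩ hj₂_one hext.map_one hcc
  replace hV : ∀ (s : S₁) x y, ⟪V x, θ (j₂ s) (V y)⟫_ℂ = ⟪x, π₁ s y⟫_ℂ := hV
  set π₂ := compression (θ.comp (q l).proj) V with hπ₂
  have hπ₂φ : ∀ s : S₁, π₂ (φ s : A₂) = π₁ (s : A₁) := fun s => by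
    ext y
    refine ext_inner_left ℂ fun x => ?_
    rw [hπ₂, inner_compression]
    exact hV s x y
  have hπ₂_mul := compression_mul _ _ (hinv θ V hV)
  have hπ₂_bound : ∀ a, ‖π₂ a‖ ≤ q l a := fun a =>
    (norm_compression_le _ _ a).trans (hbound θ a)
  refine ⟨π₂, ⟨⟨hπ₂_mul, compression_star _ _, l, hπ₂_bound⟩, fun T hT => ?_, l,
    ⟨compression_one _ _, isLocalCP_compression _ _ q l (hbound θ), fun _ _ => rfl, hπ₂_bound⟩,
    fun ψ hψ => ?_⟩, hπ₂φ⟩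
  · refine hπ₁.irreducible T (hgen₁.induction hS₁ ?_ ?_ ?_ ?_)
    · have hcont := hA₁.continuous_of_norm_le π₁ l hext.bound
      exact isClosed_eq (continuous_const.mul hcont) (hcont.mul continuous_const)
    · intro s hs
      rw [← hπ₂φ ⟨s, hs⟩, hT]
    · intro a b ha hb
      rw [map_add, mul_add, add_mul, ha, hb]
    · intro a b ha hb
      rw [hπ₁.localRep.map_mul, ← mul_assoc, ha, mul_assoc, hb, mul_assoc]
  · obtain ⟨κ', θ', V', hθ'⟩ := hψ.localCP.exists_dilation hψ.map_one hψ.bound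
    have hV' : ∀ (s : S₁) x y, ⟪V' x, θ' (j₂ s) (V' y)⟫_ℂ = ⟪x, π₁ s y⟫_ℂ := fun s x y => by
      rw [← hπ₂φ, ← hψ.eqOn _ (φ s).2, hθ', inner_compression]
      rfl
    have hψ_mul : ∀ a b, ψ (a * b) = ψ a * ψ b := by
      rw [hθ']
      exact compression_mul _ _ (hinv θ' V' hV')
    exact eq_of_eqOn_generators hA₂ hgen₂ hS₂ hπ₂_bound hψ.bound hπ₂_mul hψ_mul hψ.eqOn
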